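/- **Notation.** Let $\langle x,y\rangle=-x_0y_0+x_1y_1+x_2y_2$ be the Minkowski form on $\mathbb R^{3}$, let $x\boxtimes y$ be the vector with $\langle x\boxtimes y,v\rangle=\det(x,y,v)$ for all $v$, and let $\mathbb H^2=\{p:\langle p,p\rangle=-1,\ p_0>0\}$ with the induced Riemannian metric $g$, its Levi-Civita connection $\nabla$, and the complex structure $\mathrm J_p(v)=p\boxtimes v$. Write $\mathbb D$ for the open unit disk in $\mathbb C$, $\mathbb S^1$ for its boundary, $\Pi:\mathbb H^2\to\mathbb D$, $\Pi(p)=\frac{p_1+ip_2}{p_0}$ (Klein model) and $G:\mathbb H^2\to\mathbb D$, $G(p)=\frac{p_1+ip_2}{1+p_0}$ (Poincaré model). For $u:\mathbb H^2\to\mathbb R$ put $\overline u(\eta)=\sqrt{1-|\eta|^2}\,u(\Pi^{-1}(\eta))$, $\eta\in\mathbb D$; "$\overline u=\varphi$ on $\mathbb S^1$" means that $\overline u$ extends continuously to $\mathbb S^1$ by $\varphi$. Let $\Delta u=\operatorname{tr}(v\mapsto\nabla_v\operatorname{grad}u)$. Split $\mathrm T\mathrm T\mathbb H^2$ into horizontal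 and vertical parts with $\nabla$, so that $\mathrm T_{(x,v)}\mathrm T\mathbb H^2\cong \mathrm T_x\mathbb H^2\times \mathrm T_x\mathbb H^2$, and put $$\mathbb G\big((X_1,X_2),(Y_1,Y_2)\big)=g(X_1,Y_2)+g(X_2,Y_1),\qquad \Omega\big((X_1,X_2),(Y_1,Y_2)\big)=g(\mathrm JX_1,Y_2)-g(X_2,\mathrm JY_1).$$ A smooth vector field $V$ on $\mathbb H^2$ is *harmonic Lagrangian* if $V:(\mathbb H^2,g)\to(\mathrm T\mathbb H^2,\mathbb G)$ is a harmonic map (its tension field vanishes) and $V(\mathbb H^2)$ is Lagrangian for $\Omega$ (that is, $V^*\Omega=0$). **Theorem.** Let $X$ be a continuous tangent vector field on $\mathbb S^1$, and let $\phi_X:\mathbb S^1\to\mathbb R$ be its support function, defined by $X(\zeta)=i\zeta\,\phi_X(\zeta)$. Then there is a smooth function $u_X:\mathbb H^2\to\mathbb R$ with $$\Delta u_X-2u_X=0\ \text{ on }\mathbb H^2,\qquad \overline{u_X}=\phi_X\ \text{ on }\mathbb S^1,$$ and it is the only function of class $C^2$ on $\mathbb H^2$ with these two properties. The vector field $\mathrm{HL}(X)=\mathrm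 J\operatorname{grad}u_X$ is harmonic Lagrangian and extends continuously to $X$ on $\mathbb S^1$, both in the Klein model and in the Poincaré model: for every $\zeta\in\mathbb S^1$, $$(\Pi_*\mathrm{HL}(X))(\eta)\to X(\zeta)\ \ (\mathbb D\ni\eta\to\zeta),\qquad (G_*\mathrm{HL}(X))(z)\to X(\zeta)\ \ (\mathbb D\ni z\to\zeta).$$ In particular every continuous vector field on $\mathbb S^1$ extends continuously to a harmonic Lagrangian vector field on $\mathbb H^2$. Moreover $G_*\mathrm{HL}(X)=L_0(X)$ on $\mathbb D$, where $L_0(X)$ is the infinitesimal Douady–Earle extension $$L_0(X)(z)=\frac{(1-|z|^2)^3}{2\pi i}\oint_{\mathbb S^1}\frac{X(x)}{(1-\bar z x)^3(x-z)}\,dx,\qquad z\in\mathbb D.$$ -/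

import Mathlib

open scoped ContDiff Topology

namespace HLExt

noncomputable section

/-! ### Minkowski space and the hyperboloid -/

/-- The Minkowski form `-x₀y₀ + x₁y₁ + x₂y₂`. -/
def mink (x y : Fin 3 → ℝ) : ℝ := -(x 0 * y 0) + x 1 * y 1 + x 2 * y 2

/-- The Minkowski cross product; see `mink_cross` for its defining property. -/
def cross (x y : Fin 3 → ℝ) : Fin 3 → ℝ :=
  ![-(x 1 * y 2 - x 2 * y 1), x 2 * y 0 - x 0 * y 2, x 0 * y 1 - x 1 * y 0]

theorem mink_cross (x y v : Fin 3 → ℝ) :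
    mink (cross x y) v = Matrix.det (Matrix.of ![x, y, v]) := by
  simp [mink, cross, Matrix.det_fin_three]
  ring

/-- The hyperbolic plane: the upper sheet of the hyperboloid. Functions and vector fields on it are
total functions on `Fin 3 → ℝ` of which only the values on `H2` matter. -/
def H2 : Set (Fin 3 → ℝ) := {p | mink p p = -1 ∧ 0 < p 0}

/-- The almost complex structure `J_p v = p ⊠ v` applied to a vector field. -/
def J (V : (Fin 3 → ℝ) → (Fin 3 → ℝ)) : (Fin 3 → ℝ) → (Fin 3 → ℝ) := fun p => cross p (V p)

/-! ### The Klein and Poincaré models -/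

/-- The open unit disk. -/
def disk : Set ℂ := Metric.ball 0 1

/-- The radial projection `Π` onto the Klein disk. -/
def klein (x : Fin 3 → ℝ) : ℂ := ⟨x 1 / x 0, x 2 / x 0⟩

/-- The inverse of `Π` from the disk to `H2`. -/
def kleinInv (η : ℂ) : Fin 3 → ℝ :=
  ![1 / √(1 - ‖η‖ ^ 2), η.re / √(1 - ‖η‖ ^ 2), η.im / √(1 - ‖η‖ ^ 2)]

/-- The isometry `G` from `H2` onto the Poincaré disk, which serves as a global chart of `H2`. -/
def G (x : Fin 3 → ℝ) : ℂ := ⟨x 1 / (1 + x 0), x 2 / (1 + x 0)⟩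

/-- The inverse of `G` from the disk to `H2`. -/
def Ginv (z : ℂ) : Fin 3 → ℝ :=
  ![(1 + ‖z‖ ^ 2) / (1 - ‖z‖ ^ 2), 2 * z.re / (1 - ‖z‖ ^ 2), 2 * z.im / (1 - ‖z‖ ^ 2)]

/-- The push-forward `Π_* V` of a vector field to the Klein disk. -/
def kleinPush (V : (Fin 3 → ℝ) → (Fin 3 → ℝ)) (η : ℂ) : ℂ :=
  fderiv ℝ klein (kleinInv η) (V (kleinInv η))

/-- The push-forward `G_* V` of a vector field to the Poincaré disk. -/
def GPush (V : (Fin 3 → ℝ) → (Fin 3 → ℝ)) (z : ℂ) : ℂ :=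
  fderiv ℝ G (Ginv z) (V (Ginv z))

/-- The hyperbolic metric in the chart `G`: the pull-back of the Minkowski form by `G⁻¹`. -/
def hypMetric (z a b : ℂ) : ℝ := mink (fderiv ℝ Ginv z a) (fderiv ℝ Ginv z b)

/-- The almost complex structure of `H2` in the chart `G`. -/
def chartJ (z a : ℂ) : ℂ := fderiv ℝ G (Ginv z) (cross (Ginv z) (fderiv ℝ Ginv z a))

/-! ### Pseudo-Riemannian geometry on open subsets of a vector space -/

section Connection

variable {E : Type*} [NormedAddCommGroup E] [NormedSpace ℝ E]

/-- The Christoffel symbol `Γ_x(a, b)` of the Levi-Civita connection of a pseudo-Riemannian metric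
`g` on an open subset of `E`: the vector `∇_a b` for the constant vector fields `a` and `b`, which
is determined by the Koszul formula. -/
def christoffel (g : E → E → E → ℝ) (x a b : E) : E :=
  Classical.epsilon fun w : E => ∀ c : E,
    2 * g x w c = fderiv ℝ (fun y => g y b c) x a + fderiv ℝ (fun y => g y a c) x b
      - fderiv ℝ (fun y => g y a b) x c

/-- The Levi-Civita covariant derivative `∇_a W` at `x`. -/
def covDeriv (g : E → E → E → ℝ) (W : E → E) (x a : E) : E :=
  fderiv ℝ W x a + christoffel g x a (W x)

variable {E' : Type*} [NormedAddCommGroup E'] [NormedSpace ℝ E']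

/-- The second covariant derivative
`∇²F(a, b) = ∇^N_{dF(a)} dF(b) - dF(∇^M_a b)` at `x` of a map `F` between open subsets of
`E` and `E'` with metrics `g` and `g'`, for the constant vector fields `a` and `b`. -/
def secondCovDeriv (g : E → E → E → ℝ) (g' : E' → E' → E' → ℝ) (F : E → E') (x a b : E) : E' :=
  fderiv ℝ (fun y => fderiv ℝ F y b) x a
    + christoffel g' (F x) (fderiv ℝ F x a) (fderiv ℝ F x b)
    - fderiv ℝ F x (christoffel g x a b)

/-- A smooth map `F` from an open set `U ⊆ ℂ` with Riemannian metric `g` to an open subset of `E'`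
with pseudo-Riemannian metric `g'` is harmonic: its tension field, the sum of `∇²F(eᵢ, eᵢ)` over a
`g`-orthonormal basis `e₁, e₂`, vanishes on `U`. -/
def IsHarmonicMapOn (g : ℂ → ℂ → ℂ → ℝ) (g' : E' → E' → E' → ℝ) (U : Set ℂ) (F : ℂ → E') : Prop :=
  ContDiffOn ℝ ∞ F U ∧
  ∀ x ∈ U, ∀ e₁ e₂ : ℂ, g x e₁ e₁ = 1 → g x e₂ e₂ = 1 → g x e₁ e₂ = 0 →
    secondCovDeriv g g' F x e₁ e₁ + secondCovDeriv g g' F x e₂ e₂ = 0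

end Connection

/-! ### Gradient and Laplacian of functions on `H2` -/

/-- `u` is of class `C^n` on `H2`. -/
def ContDiffH2 (n : WithTop ℕ∞) (u : (Fin 3 → ℝ) → ℝ) : Prop :=
  ContDiffOn ℝ n (fun z => u (Ginv z)) disk

/-- The hyperbolic gradient: the tangent vector `w` at `p` with `⟨w, t⟩ = du_p(t)` for all
`t ∈ T_p H2`, where the tangent vectors `t` are written as `d(G⁻¹)(c)`, `c ∈ ℂ`. -/
def grad (u : (Fin 3 → ℝ) → ℝ) (p : Fin 3 → ℝ) : Fin 3 → ℝ :=
  Classical.epsilon fun w : Fin 3 → ℝ => mink p w = 0 ∧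
    ∀ c : ℂ, mink w (fderiv ℝ Ginv (G p) c) = fderiv ℝ (fun z => u (Ginv z)) (G p) c

/-- The Laplace-Beltrami operator: the trace of `v ↦ ∇_v grad u`, computed in the chart `G` with the
basis `1, i` of `ℂ`. -/
def laplacian (u : (Fin 3 → ℝ) → ℝ) (p : Fin 3 → ℝ) : ℝ :=
  (covDeriv hypMetric (GPush (grad u)) (G p) 1).re
    + (covDeriv hypMetric (GPush (grad u)) (G p) Complex.I).im

/-- The function `ū(η) = √(1 - |η|²) u(Π⁻¹(η))` on the Klein disk. -/
def bar (u : (Fin 3 → ℝ) → ℝ) (η : ℂ) : ℝ := √(1 - ‖η‖ ^ 2) * u (kleinInv η)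

/-- A function on the open unit disk extends continuously to the unit circle by `f`. -/
def HasBoundaryValue {Y : Type*} [TopologicalSpace Y] (h f : ℂ → Y) : Prop :=
  ∀ ζ ∈ Metric.sphere (0 : ℂ) 1, Filter.Tendsto h (𝓝[disk] ζ) (𝓝 (f ζ))

/-- `u` solves `Δu - 2u = 0` on `H2` and `ū = φ` on the unit circle. -/
def SolvesDirichlet (φ : ℂ → ℝ) (u : (Fin 3 → ℝ) → ℝ) : Prop :=
  (∀ p ∈ H2, laplacian u p - 2 * u p = 0) ∧ HasBoundaryValue (bar u) φ

/-! ### The tangent bundle of `H2` and harmonic Lagrangian vector fields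

The tangent bundle is described in the chart induced by `G`: the pair `(z, v)` in `disk × ℂ` stands
for the vector `d(G⁻¹)_z(v)` at `G⁻¹(z)`. -/

/-- The horizontal lift of `w` at `P = (z, v)`: the velocity of the parallel field with value `v`
along a curve with velocity `w`. -/
def horLift (P : ℂ × ℂ) (w : ℂ) : ℂ × ℂ := (w, -christoffel hypMetric P.1 w P.2)

/-- The vertical lift of `w`. -/
def verLift (w : ℂ) : ℂ × ℂ := (0, w)

/-- The vertical component of a vector `ξ` tangent to the tangent bundle at `P`; the horizontal
component is `ξ.1`. -/
def verPart (P ξ : ℂ × ℂ) : ℂ := ξ.2 + christoffel hypMetric P.1 ξ.1 P.2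

theorem horLift_add_verLift (P ξ : ℂ × ℂ) :
    horLift P ξ.1 + verLift (verPart P ξ) = ξ := by
  simp [horLift, verLift, verPart]

/-- The metric `𝔾((X₁, X₂), (Y₁, Y₂)) = g(X₁, Y₂) + g(X₂, Y₁)` of the tangent bundle. -/
def GG (P ξ ζ : ℂ × ℂ) : ℝ :=
  hypMetric P.1 ξ.1 (verPart P ζ) + hypMetric P.1 (verPart P ξ) ζ.1

/-- The symplectic form `Ω((X₁, X₂), (Y₁, Y₂)) = g(J X₁, Y₂) - g(X₂, J Y₁)` of the tangent
bundle. -/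
def Omega (P ξ ζ : ℂ × ℂ) : ℝ :=
  hypMetric P.1 (chartJ P.1 ξ.1) (verPart P ζ) - hypMetric P.1 (verPart P ξ) (chartJ P.1 ζ.1)

/-- The vector field `V` on `H2` as a map to the tangent bundle, in the chart. -/
def sectionMap (V : (Fin 3 → ℝ) → (Fin 3 → ℝ)) (z : ℂ) : ℂ × ℂ := (z, GPush V z)

/-- Harmonic Lagrangian vector fields: tangent fields `V` on `H2` that are (smooth) harmonic maps to
the tangent bundle with the metric `𝔾` and whose image is Lagrangian, that is, `V^* Ω = 0`. -/
def IsHarmonicLagrangian (V : (Fin 3 → ℝ) → (Fin 3 → ℝ)) : Prop :=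
  (∀ p ∈ H2, mink p (V p) = 0) ∧
  IsHarmonicMapOn hypMetric GG disk (sectionMap V) ∧
  ∀ z ∈ disk, ∀ a b : ℂ,
    Omega (sectionMap V z) (fderiv ℝ (sectionMap V) z a) (fderiv ℝ (sectionMap V) z b) = 0

/-! ### Vector fields on the circle -/

/-- `X` is a continuous tangent vector field on the unit circle. -/
def IsCircleField (X : ℂ → ℂ) : Prop :=
  ContinuousOn X (Metric.sphere 0 1) ∧
  ∀ ζ ∈ Metric.sphere (0 : ℂ) 1, ((starRingEnd ℂ) ζ * X ζ).re = 0

/-- The support function `φ_X`, with `X(ζ) = i ζ φ_X(ζ)` for tangent vector fields `X`. -/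
def support (X : ℂ → ℂ) (ζ : ℂ) : ℝ := (X ζ / (Complex.I * ζ)).re

theorem eq_support {X : ℂ → ℂ} (hX : IsCircleField X) {ζ : ℂ}
    (hζ : ζ ∈ Metric.sphere (0 : ℂ) 1) : X ζ = Complex.I * ζ * support X ζ := by
  have h1 : ‖ζ‖ = 1 := by simpa using hζ
  have h0 : ζ ≠ 0 := by
    intro h
    simp [h] at h1
  have hI : Complex.I * ζ ≠ 0 := mul_ne_zero Complex.I_ne_zero h0
  have hinv : ζ⁻¹ = (starRingEnd ℂ) ζ := Complex.inv_eq_conj h1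
  have him : (X ζ / (Complex.I * ζ)).im = 0 := by
    have : X ζ / (Complex.I * ζ) = -Complex.I * ((starRingEnd ℂ) ζ * X ζ) := by
      rw [← hinv, div_eq_mul_inv, mul_inv, Complex.inv_I]
      ring
    rw [this]
    have h2 := hX.2 ζ hζ
    simp only [Complex.mul_im, Complex.neg_re, Complex.neg_im, Complex.I_re, Complex.I_im, h2]
    simp
  have : ((support X ζ : ℝ) : ℂ) = X ζ / (Complex.I * ζ) := by
    apply Complex.ext
    · simp [support]
    · rw [him]
      simp
  rw [this, mul_div_cancel₀ _ hI]

/-- The infinitesimal Douady-Earle extension of `X`, a vector field on the Poincaré disk. -/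
def L0 (X : ℂ → ℂ) (z : ℂ) : ℂ :=
  ((1 - ‖z‖ ^ 2 : ℝ) : ℂ) ^ 3 / (2 * Real.pi * Complex.I) *
    ∮ x in C(0, 1), X x / ((1 - (starRingEnd ℂ) z * x) ^ 3 * (x - z))

end

end HLExt

/-! Everything is computed in the Poincaré disk, with `dd z = 1 - |z|²`, metric `4 dd⁻² |a|²` and
Christoffel symbol `2 z̄ a b / dd` (`gam`). In these coordinates `J` is multiplication by `i`.

Existence rests on a formula of Weierstrass type: for holomorphic `F`, the function `u = Re(z F') +
(2/dd - 1) Re F` (`holSol`) solves `Δu = 2u`. Its gradient `W` (`holGrad`) satisfies `∇_a W = u a +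
q ā` with `q = dd² conj(3F'' + zF''')/4`. The real coefficient `u` gives the equation (the trace is
`2u`) and makes `J W` Lagrangian, since that condition only says that the complex-linear part of
`∇V` has real part zero. Because the squares of an orthonormal basis sum to zero, harmonicity of a
section `V` reduces to `∂_z(dd⁻² V_z̄) = 0`; for `V = iW` it holds because `dd⁻² q` is
antiholomorphic.

Taking for `F` the Herglotz integral of `φ` turns these formulas into integrals over the circle: `u`
is the average of `φ P²`, with `P` the Poisson kernel (`diskSol_eq`), and `i W` is the integral `L0`
(`diskGrad_eq`, `L0_eq`). The kernel of `W` has modulus `dd P²`, which has bounded mass and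
concentrates at the boundary point (`tendsto_circleAverage_abs_sub`). For `φ = 1` one has `u = x₀`
and `W = z` exactly, so subtracting this case gives all boundary values. The limit passes to the
Klein model because the differential of the coordinate change fixes tangential vectors on the
circle.

Uniqueness is a maximum principle (`le_of_solves`) with the comparison function `1/dd = (1 + x₀)/2`,
for which `Δ(1/dd) - 2/dd = -1`. -/

namespace HLExt

noncomputable section

open ComplexConjugate

/-! ### Wirtinger calculus -/

/-- The real-linear map `a ↦ p a + q ā`. -/
def wirt (p q : ℂ) : ℂ →L[ℝ] ℂ :=
  p • ContinuousLinearMap.id ℝ ℂ + q • (Complex.conjCLE : ℂ →L[ℝ] ℂ)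

@[simp] theorem wirt_apply (p q a : ℂ) : wirt p q a = p * a + q * conj a := by
  simp [wirt]

/-- `f` is real differentiable at `z` with Wirtinger derivatives `f_z = p` and `f_z̄ = q`. -/
def HasWirt (f : ℂ → ℂ) (p q z : ℂ) : Prop := HasFDerivAt f (wirt p q) z

namespace HasWirt

variable {f g : ℂ → ℂ} {p q p' q' z : ℂ}

theorem congr_deriv (h : HasWirt f p q z) (hp : p = p') (hq : q = q') : HasWirt f p' q' z :=
  hp ▸ hq ▸ h

theorem add (hf : HasWirt f p q z) (hg : HasWirt g p' q' z) :
    HasWirt (fun y => f y + g y) (p + p') (q + q') z := by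
  refine (HasFDerivAt.add hf hg).congr_fderiv ?_
  ext a; simp; ring

theorem mul (hf : HasWirt f p q z) (hg : HasWirt g p' q' z) :
    HasWirt (fun y => f y * g y) (p * g z + f z * p') (q * g z + f z * q') z := by
  refine (HasFDerivAt.mul hf hg).congr_fderiv ?_
  ext a; simp; ring

theorem conjugate (hf : HasWirt f p q z) :
    HasWirt (fun y => conj (f y)) (conj q) (conj p) z := by
  refine ((Complex.conjCLE : ℂ →L[ℝ] ℂ).hasFDerivAt.comp z hf).congr_fderiv ?_
  ext a; simp; ring

theorem const (c z : ℂ) : HasWirt (fun _ => c) 0 0 z := by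
  refine (hasFDerivAt_const c z).congr_fderiv ?_
  ext a; simp

theorem id (z : ℂ) : HasWirt (fun y => y) 1 0 z := by
  refine (hasFDerivAt_id z).congr_fderiv ?_
  ext a; simp

theorem const_mul (c : ℂ) (hf : HasWirt f p q z) :
    HasWirt (fun y => c * f y) (c * p) (c * q) z := by
  simpa using (const c z).mul hf

theorem inv (hf : HasWirt f p q z) (h0 : f z ≠ 0) :
    HasWirt (fun y => (f y)⁻¹) (-p / f z ^ 2) (-q / f z ^ 2) z := by
  refine (((hasDerivAt_inv h0).hasFDerivAt.restrictScalars ℝ).comp z hf).congr_fderiv ?_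
  ext a; simp; ring

theorem of_hasDerivAt (hf : HasDerivAt f p z) : HasWirt f p 0 z := by
  refine (hf.hasFDerivAt.restrictScalars ℝ).congr_fderiv ?_
  ext a; simp; ring

theorem fderiv_apply (h : HasWirt f p q z) (a : ℂ) :
    fderiv ℝ f z a = p * a + q * (starRingEnd ℂ) a := by
  rw [HasFDerivAt.fderiv h, wirt_apply]

end HasWirt

/-! ### The hyperbolic metric in the Poincaré disk -/

/-- `1 - |z|²`. -/
def dd (z : ℂ) : ℝ := 1 - (z.re * z.re + z.im * z.im)

/-- The real inner product with `z` as a continuous linear form. -/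
def ipCLM (z : ℂ) : ℂ →L[ℝ] ℝ := z.re • Complex.reCLM + z.im • Complex.imCLM

@[simp] theorem ipCLM_apply (z a : ℂ) : ipCLM z a = z.re * a.re + z.im * a.im := by
  simp [ipCLM]

theorem one_sub_norm_sq (z : ℂ) : 1 - ‖z‖ ^ 2 = dd z := by
  rw [dd, Complex.sq_norm, Complex.normSq_apply]

theorem one_add_norm_sq (z : ℂ) : 1 + ‖z‖ ^ 2 = 2 - dd z := by
  rw [← one_sub_norm_sq]; ring

theorem dd_pos {z : ℂ} (hz : z ∈ disk) : 0 < dd z := by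
  have : ‖z‖ < 1 := by simpa [disk] using hz
  rw [← one_sub_norm_sq]
  nlinarith [norm_nonneg z]

theorem dd_le_one (z : ℂ) : dd z ≤ 1 := by
  rw [← one_sub_norm_sq]
  nlinarith [norm_nonneg z]

theorem ofReal_dd (z : ℂ) : (dd z : ℂ) = 1 - z * conj z := by
  rw [Complex.mul_conj, dd, Complex.normSq_apply]; push_cast; ring

theorem isOpen_disk : IsOpen disk := Metric.isOpen_ball

theorem disk_mem_nhds {z : ℂ} (hz : z ∈ disk) : disk ∈ 𝓝 z := isOpen_disk.mem_nhds hz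

theorem hasFDerivAt_re (z : ℂ) : HasFDerivAt Complex.re Complex.reCLM z :=
  Complex.reCLM.hasFDerivAt

theorem hasFDerivAt_im (z : ℂ) : HasFDerivAt Complex.im Complex.imCLM z :=
  Complex.imCLM.hasFDerivAt

theorem hasFDerivAt_dd (z : ℂ) : HasFDerivAt dd ((-2 : ℝ) • ipCLM z) z := by
  refine ((((hasFDerivAt_re z).mul (hasFDerivAt_re z)).add
    ((hasFDerivAt_im z).mul (hasFDerivAt_im z))).const_sub 1).congr_fderiv ?_
  ext a; simp; ring

theorem hasFDerivAt_dd_inv {z : ℂ} (hz : z ∈ disk) :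
    HasFDerivAt (fun y => (dd y)⁻¹) ((2 * (dd z)⁻¹ ^ 2) • ipCLM z) z := by
  refine ((hasDerivAt_inv (dd_pos hz).ne').comp_hasFDerivAt z (hasFDerivAt_dd z)).congr_fderiv ?_
  ext a; simp; ring

/-- The product `dd z * (dd z)⁻¹` is left unevaluated so that the formula also holds on the unit
circle, where both factors are zero. -/
theorem Ginv_eq (z : ℂ) :
    Ginv z = ![2 * (dd z)⁻¹ - (dd z) * (dd z)⁻¹, 2 * z.re * (dd z)⁻¹, 2 * z.im * (dd z)⁻¹] := by
  simp only [Ginv, one_sub_norm_sq, one_add_norm_sq]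
  ext i; fin_cases i <;> simp <;> ring

theorem Ginv_eq_of_mem {z : ℂ} (hz : z ∈ disk) :
    Ginv z = ![2 * (dd z)⁻¹ - 1, 2 * z.re * (dd z)⁻¹, 2 * z.im * (dd z)⁻¹] := by
  rw [Ginv_eq, mul_inv_cancel₀ (dd_pos hz).ne']

theorem hasFDerivAt_Ginv {z : ℂ} (hz : z ∈ disk) : HasFDerivAt Ginv (ContinuousLinearMap.pi
    ![(4 * (dd z)⁻¹ ^ 2) • ipCLM z,
      (2 * (dd z)⁻¹) • Complex.reCLM + (4 * z.re * (dd z)⁻¹ ^ 2) • ipCLM z,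
      (2 * (dd z)⁻¹) • Complex.imCLM + (4 * z.im * (dd z)⁻¹ ^ 2) • ipCLM z]) z := by
  have hi := hasFDerivAt_dd_inv hz
  refine HasFDerivAt.congr_of_eventuallyEq (f := fun y : ℂ =>
    (![2 * (dd y)⁻¹ - 1, 2 * y.re * (dd y)⁻¹, 2 * y.im * (dd y)⁻¹] : Fin 3 → ℝ)) ?_
    (Filter.eventually_of_mem (disk_mem_nhds hz) fun y hy => Ginv_eq_of_mem hy)
  rw [hasFDerivAt_pi']
  intro i
  fin_cases i
  · refine ((hi.const_mul 2).sub_const 1).congr_fderiv ?_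
    ext a; simp; ring
  · refine (((hasFDerivAt_re z).const_mul 2).mul hi).congr_fderiv ?_
    ext a; simp; ring
  · refine (((hasFDerivAt_im z).const_mul 2).mul hi).congr_fderiv ?_
    ext a; simp; ring

theorem fderiv_Ginv {z : ℂ} (hz : z ∈ disk) (a : ℂ) : fderiv ℝ Ginv z a =
    ![4 * (dd z)⁻¹ ^ 2 * (z.re * a.re + z.im * a.im),
      2 * (dd z)⁻¹ * a.re + 4 * z.re * (dd z)⁻¹ ^ 2 * (z.re * a.re + z.im * a.im),
      2 * (dd z)⁻¹ * a.im + 4 * z.im * (dd z)⁻¹ ^ 2 * (z.re * a.re + z.im * a.im)] := by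
  rw [(hasFDerivAt_Ginv hz).fderiv]
  ext i; fin_cases i <;> simp

/-- The real inner product of the plane. -/
def ip (a b : ℂ) : ℝ := a.re * b.re + a.im * b.im

theorem hypMetric_eq {z : ℂ} (hz : z ∈ disk) (a b : ℂ) :
    hypMetric z a b = 4 * (dd z)⁻¹ ^ 2 * ip a b := by
  have h : (dd z)⁻¹ * dd z = 1 := inv_mul_cancel₀ (dd_pos hz).ne'
  simp only [hypMetric, fderiv_Ginv hz, mink, ip]
  simp [-inv_pow]
  generalize (dd z)⁻¹ = e at h
  rw [dd] at h
  linear_combination (-16 * e ^ 3 * (z.re * a.re + z.im * a.im) * (z.re * b.re + z.im * b.im)) * h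

theorem Ginv_mem_H2 {z : ℂ} (hz : z ∈ disk) : Ginv z ∈ H2 := by
  have h : (dd z)⁻¹ * dd z = 1 := inv_mul_cancel₀ (dd_pos hz).ne'
  have h1 : 1 ≤ (dd z)⁻¹ := (one_le_inv₀ (dd_pos hz)).2 (dd_le_one z)
  rw [Ginv_eq_of_mem hz]
  refine ⟨?_, ?_⟩
  · simp [mink, -inv_pow]
    generalize (dd z)⁻¹ = e at h
    rw [dd] at h
    linear_combination -4 * e * h
  · simp; linarith

theorem G_Ginv {z : ℂ} (hz : z ∈ disk) : G (Ginv z) = z := by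
  have := dd_pos hz
  rw [Ginv_eq_of_mem hz]
  apply Complex.ext <;> simp [G] <;> field_simp

theorem one_add_pos_of_mem_H2 {p : Fin 3 → ℝ} (hp : p ∈ H2) : 0 < 1 + p 0 := by linarith [hp.2]

theorem dd_G {p : Fin 3 → ℝ} (hp : p ∈ H2) : dd (G p) = 2 / (1 + p 0) := by
  have h0 := one_add_pos_of_mem_H2 hp
  have h1 := hp.1
  simp only [mink] at h1
  simp only [dd, G]
  field_simp
  linear_combination -h1

theorem G_mem_disk {p : Fin 3 → ℝ} (hp : p ∈ H2) : G p ∈ disk := by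
  have h0 := one_add_pos_of_mem_H2 hp
  have h2 : 0 < dd (G p) := by rw [dd_G hp]; positivity
  rw [← one_sub_norm_sq] at h2
  have : ‖G p‖ < 1 := by nlinarith [norm_nonneg (G p)]
  simpa [disk] using this

theorem Ginv_G {p : Fin 3 → ℝ} (hp : p ∈ H2) : Ginv (G p) = p := by
  have h0 := one_add_pos_of_mem_H2 hp
  rw [Ginv_eq_of_mem (G_mem_disk hp), dd_G hp]
  ext i; fin_cases i <;> simp [G] <;> field_simp ; ring

theorem differentiableAt_G {p : Fin 3 → ℝ} (hp : p ∈ H2) : DifferentiableAt ℝ G p := by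
  have h0 := (one_add_pos_of_mem_H2 hp).ne'
  have : G = fun x => Complex.equivRealProdCLM.symm (x 1 / (1 + x 0), x 2 / (1 + x 0)) := by
    funext x; apply Complex.ext <;> simp [G]
  rw [this]
  fun_prop (disch := assumption)

theorem fderiv_G_fderiv_Ginv {z : ℂ} (hz : z ∈ disk) (a : ℂ) :
    fderiv ℝ G (Ginv z) (fderiv ℝ Ginv z a) = a := by
  have h1 : HasFDerivAt (G ∘ Ginv) ((fderiv ℝ G (Ginv z)).comp (fderiv ℝ Ginv z)) z :=
    (differentiableAt_G (Ginv_mem_H2 hz)).hasFDerivAt.comp z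
      (hasFDerivAt_Ginv hz).differentiableAt.hasFDerivAt
  have h2 : HasFDerivAt (G ∘ Ginv) (ContinuousLinearMap.id ℝ ℂ) z :=
    (hasFDerivAt_id z).congr_of_eventuallyEq
      (Filter.eventually_of_mem (disk_mem_nhds hz) fun y hy => G_Ginv hy)
  simpa using congrArg (fun L : ℂ →L[ℝ] ℂ => L a) (h1.unique h2)

theorem mink_Ginv_fderiv_Ginv {z : ℂ} (hz : z ∈ disk) (a : ℂ) :
    mink (Ginv z) (fderiv ℝ Ginv z a) = 0 := by
  have h : (dd z)⁻¹ * dd z = 1 := inv_mul_cancel₀ (dd_pos hz).ne'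
  rw [Ginv_eq_of_mem hz, fderiv_Ginv hz]
  simp [mink, -inv_pow]
  generalize (dd z)⁻¹ = e at h
  rw [dd] at h
  linear_combination (-8 * e ^ 2 * (z.re * a.re + z.im * a.im)) * h

/-- `Ginv` is conformal and preserves orientation, so the rotation `p ⊠ ·` of the tangent plane
corresponds to multiplication by `i`. -/
theorem cross_Ginv_fderiv_Ginv {z : ℂ} (hz : z ∈ disk) (a : ℂ) :
    cross (Ginv z) (fderiv ℝ Ginv z a) = fderiv ℝ Ginv z (Complex.I * a) := by
  have h : (dd z)⁻¹ * dd z = 1 := inv_mul_cancel₀ (dd_pos hz).ne'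
  rw [Ginv_eq_of_mem hz, fderiv_Ginv hz, fderiv_Ginv hz]
  ext i
  fin_cases i
  · simp [cross]; ring
  · simp [cross, -inv_pow]
    generalize (dd z)⁻¹ = e at h
    rw [dd] at h
    linear_combination (-4 * e * a.im) * h
  · simp [cross, -inv_pow]
    generalize (dd z)⁻¹ = e at h
    rw [dd] at h
    linear_combination (4 * e * a.re) * h

theorem chartJ_eq {z : ℂ} (hz : z ∈ disk) (a : ℂ) : chartJ z a = Complex.I * a := by
  rw [chartJ, cross_Ginv_fderiv_Ginv hz, fderiv_G_fderiv_Ginv hz]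

/-! ### Levi-Civita connections of the disk and of its tangent bundle -/

/-- The choice operator in `christoffel` is pinned down by exhibiting one solution of the Koszul
formula and using nondegeneracy of `g` at `x`. -/
theorem christoffel_eq {E : Type*} [NormedAddCommGroup E] [NormedSpace ℝ E] {g : E → E → E → ℝ}
    {x a b w : E}
    (hw : ∀ c : E, 2 * g x w c = fderiv ℝ (fun y => g y b c) x a + fderiv ℝ (fun y => g y a c) x b
      - fderiv ℝ (fun y => g y a b) x c)
    (hg : ∀ w₁ w₂, (∀ c, g x w₁ c = g x w₂ c) → w₁ = w₂) : christoffel g x a b = w := by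
  have h := Classical.epsilon_spec (p := fun w : E => ∀ c : E,
    2 * g x w c = fderiv ℝ (fun y => g y b c) x a + fderiv ℝ (fun y => g y a c) x b
      - fderiv ℝ (fun y => g y a b) x c) ⟨w, hw⟩
  refine hg _ _ fun c => ?_
  have h1 := h c
  have h2 := hw c
  simp only [christoffel]
  linarith

theorem eq_of_forall_ip {a b : ℂ} (h : ∀ c, ip a c = ip b c) : a = b := by
  apply Complex.ext
  · simpa [ip] using h 1
  · simpa [ip] using h Complex.I

theorem hasFDerivAt_hypMetric {z : ℂ} (hz : z ∈ disk) (b c : ℂ) :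
    HasFDerivAt (fun y => hypMetric y b c) ((16 * (dd z)⁻¹ ^ 3 * ip b c) • ipCLM z) z := by
  refine HasFDerivAt.congr_of_eventuallyEq (f := fun y => 4 * (dd y)⁻¹ ^ 2 * ip b c) ?_
    (Filter.eventually_of_mem (disk_mem_nhds hz) fun y hy => hypMetric_eq hy b c)
  refine ((((hasFDerivAt_dd_inv hz).pow 2).const_mul 4).mul_const (ip b c)).congr_fderiv ?_
  ext a; simp; ring

/-- The Christoffel symbol `2 z̄ a b / (1 - |z|²)` of the Poincaré disk. -/
def gam (z a b : ℂ) : ℂ := 2 * conj z * a * b * ((dd z)⁻¹ : ℝ)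

theorem christoffel_hypMetric {z : ℂ} (hz : z ∈ disk) (a b : ℂ) :
    christoffel hypMetric z a b = gam z a b := by
  have h0 := dd_pos hz
  refine christoffel_eq (fun c => ?_) fun w₁ w₂ h => eq_of_forall_ip fun c => ?_
  · rw [(hasFDerivAt_hypMetric hz _ _).fderiv, (hasFDerivAt_hypMetric hz _ _).fderiv,
      (hasFDerivAt_hypMetric hz _ _).fderiv, hypMetric_eq hz]
    simp [ip, gam, -inv_pow, -Complex.ofReal_inv]
    ring
  · have := h c
    rw [hypMetric_eq hz, hypMetric_eq hz] at this
    exact mul_left_cancel₀ (by positivity) this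

theorem hasFDerivAt_ip (P : ℂ × ℂ) :
    HasFDerivAt (fun Q : ℂ × ℂ => ip Q.1 Q.2)
      ((ipCLM P.2).comp (ContinuousLinearMap.fst ℝ ℂ ℂ)
        + (ipCLM P.1).comp (ContinuousLinearMap.snd ℝ ℂ ℂ)) P := by
  have h1 : HasFDerivAt (fun Q : ℂ × ℂ => Q.1) (ContinuousLinearMap.fst ℝ ℂ ℂ) P := hasFDerivAt_fst
  have h2 : HasFDerivAt (fun Q : ℂ × ℂ => Q.2) (ContinuousLinearMap.snd ℝ ℂ ℂ) P := hasFDerivAt_snd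
  refine ((((hasFDerivAt_re P.1).comp P h1).mul ((hasFDerivAt_re P.2).comp P h2)).add
    (((hasFDerivAt_im P.1).comp P h1).mul ((hasFDerivAt_im P.2).comp P h2))).congr_fderiv ?_
  ext a <;> simp

/-- By metric compatibility the two Christoffel terms add up to the derivative of `g(ξ.1, ζ.1)` in
the direction `P.2`. Thus `𝔾` is the linearization of `g` along the fibre, which is why its
connection is the linearized one. -/
theorem GG_eq {P : ℂ × ℂ} (hP : P.1 ∈ disk) (ξ ζ : ℂ × ℂ) :
    GG P ξ ζ = 16 * (dd P.1)⁻¹ ^ 3 * ip P.1 P.2 * ip ξ.1 ζ.1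
      + 4 * (dd P.1)⁻¹ ^ 2 * (ip ξ.1 ζ.2 + ip ξ.2 ζ.1) := by
  simp only [GG, verPart, christoffel_hypMetric hP, hypMetric_eq hP]
  simp [ip, gam, -inv_pow, -Complex.ofReal_inv]
  ring

theorem hasFDerivAt_GG {P : ℂ × ℂ} (hP : P.1 ∈ disk) (ξ ζ : ℂ × ℂ) :
    HasFDerivAt (fun Q => GG Q ξ ζ)
      ((96 * (dd P.1)⁻¹ ^ 4 * ip P.1 P.2 * ip ξ.1 ζ.1
          + 16 * (dd P.1)⁻¹ ^ 3 * (ip ξ.1 ζ.2 + ip ξ.2 ζ.1)) •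
          (ipCLM P.1).comp (ContinuousLinearMap.fst ℝ ℂ ℂ)
        + (16 * (dd P.1)⁻¹ ^ 3 * ip ξ.1 ζ.1) • ((ipCLM P.2).comp (ContinuousLinearMap.fst ℝ ℂ ℂ)
        + (ipCLM P.1).comp (ContinuousLinearMap.snd ℝ ℂ ℂ))) P := by
  have h1 : HasFDerivAt (fun Q : ℂ × ℂ => Q.1) (ContinuousLinearMap.fst ℝ ℂ ℂ) P := hasFDerivAt_fst
  have hd : HasFDerivAt (fun Q : ℂ × ℂ => (dd Q.1)⁻¹) _ P := (hasFDerivAt_dd_inv hP).comp P h1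
  have hmem : ∀ᶠ Q : ℂ × ℂ in 𝓝 P, Q.1 ∈ disk :=
    continuous_fst.continuousAt.eventually (disk_mem_nhds hP)
  refine HasFDerivAt.congr_of_eventuallyEq (f := fun Q : ℂ × ℂ =>
    16 * (dd Q.1)⁻¹ ^ 3 * ip Q.1 Q.2 * ip ξ.1 ζ.1
      + 4 * (dd Q.1)⁻¹ ^ 2 * (ip ξ.1 ζ.2 + ip ξ.2 ζ.1)) ?_
    (hmem.mono fun Q hQ => GG_eq hQ ξ ζ)
  refine (((((hd.pow 3).const_mul 16).mul (hasFDerivAt_ip P)).mul_const (ip ξ.1 ζ.1)).add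
    (((hd.pow 2).const_mul 4).mul_const (ip ξ.1 ζ.2 + ip ξ.2 ζ.1))).congr_fderiv ?_
  ext a <;> simp [-inv_pow] <;> ring

/-- The Christoffel symbol of the tangent bundle with the metric `𝔾`, the linearization of that of
the base. -/
def GGgam (P a b : ℂ × ℂ) : ℂ × ℂ :=
  (gam P.1 a.1 b.1,
    2 * conj P.2 * a.1 * b.1 * ((dd P.1)⁻¹ : ℝ)
      + 4 * conj P.1 * a.1 * b.1 * ((dd P.1)⁻¹ ^ 2 * ip P.1 P.2 : ℝ)
      + gam P.1 a.2 b.1 + gam P.1 a.1 b.2)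

theorem christoffel_GG {P : ℂ × ℂ} (hP : P.1 ∈ disk) (a b : ℂ × ℂ) :
    christoffel GG P a b = GGgam P a b := by
  have h0 := dd_pos hP
  refine christoffel_eq (fun c => ?_) fun w₁ w₂ h => ?_
  · rw [(hasFDerivAt_GG hP _ _).fderiv, (hasFDerivAt_GG hP _ _).fderiv,
      (hasFDerivAt_GG hP _ _).fderiv, GG_eq hP]
    obtain ⟨z, v⟩ := P
    obtain ⟨a₁, a₂⟩ := a
    obtain ⟨b₁, b₂⟩ := b
    obtain ⟨c₁, c₂⟩ := c
    simp [ip, gam, GGgam, -inv_pow, -Complex.ofReal_inv, -Complex.ofReal_pow, -Complex.ofReal_mul,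
      -Complex.ofReal_add]
    generalize (dd z)⁻¹ = e
    ring
  · have h4 : 4 * (dd P.1)⁻¹ ^ 2 ≠ 0 := by positivity
    -- Fibres are null for `𝔾`: vertical test vectors determine the base component, after which
    -- vectors `(c, 0)` determine the fibre component.
    have e1 : w₁.1 = w₂.1 := eq_of_forall_ip fun c => by
      have := h (0, c)
      rw [GG_eq hP, GG_eq hP] at this
      refine mul_left_cancel₀ h4 ?_
      simpa [ip] using this
    refine Prod.ext e1 (eq_of_forall_ip fun c => ?_)
    have := h (c, 0)
    rw [GG_eq hP, GG_eq hP, e1] at this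
    have h3 := add_left_cancel this
    refine mul_left_cancel₀ h4 ?_
    simpa [ip] using h3

/-! ### Gradient and Laplacian in the disk -/

/-- The gradient of a function on the Poincaré disk. -/
def gradChart (f : ℂ → ℝ) (z : ℂ) : ℂ :=
  ((dd z ^ 2 / 4 : ℝ) : ℂ) * (fderiv ℝ f z 1 + Complex.I * fderiv ℝ f z Complex.I)

/-- The point `Ginv z` and its tangent plane span Minkowski space, and the form is nondegenerate.
This makes the vector chosen in `grad` unique. -/
theorem eq_zero_of_mink {z : ℂ} (hz : z ∈ disk) {w : Fin 3 → ℝ} (h0 : mink (Ginv z) w = 0)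
    (h : ∀ c, mink w (fderiv ℝ Ginv z c) = 0) : w = 0 := by
  have hd := (dd_pos hz)
  have he : (dd z)⁻¹ * dd z = 1 := inv_mul_cancel₀ hd.ne'
  have h1 := h 1
  have h2 := h Complex.I
  rw [Ginv_eq_of_mem hz] at h0
  rw [fderiv_Ginv hz] at h1 h2
  have hen : (dd z)⁻¹ ≠ 0 := by positivity
  simp [mink, -inv_pow] at h0 h1 h2
  generalize (dd z)⁻¹ = e at *
  rw [dd] at he
  have k1 : w 1 = z.re * w 0 := mul_left_cancel₀ hen (by linear_combination h1 / 2 - z.re * e * h0)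
  have k2 : w 2 = z.im * w 0 := mul_left_cancel₀ hen (by linear_combination h2 / 2 - z.im * e * h0)
  have k0 : w 0 = 0 := by
    rw [k1, k2] at h0
    linear_combination -h0 - 2 * w 0 * he
  ext i; fin_cases i <;> simp [k0, k1, k2]

theorem fderiv_eq_ip (L : ℂ →L[ℝ] ℝ) (c : ℂ) : L c = c.re * L 1 + c.im * L Complex.I := by
  conv_lhs => rw [show c = c.re • (1 : ℂ) + c.im • Complex.I by
    apply Complex.ext <;> simp]
  rw [map_add, map_smul, map_smul]; rfl

theorem grad_Ginv (u : (Fin 3 → ℝ) → ℝ) {z : ℂ} (hz : z ∈ disk) :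
    grad u (Ginv z) = fderiv ℝ Ginv z (gradChart (fun y => u (Ginv y)) z) := by
  have hd := dd_pos hz
  have hw : mink (Ginv z) (fderiv ℝ Ginv z (gradChart (fun y => u (Ginv y)) z)) = 0 ∧
      ∀ c : ℂ, mink (fderiv ℝ Ginv z (gradChart (fun y => u (Ginv y)) z))
        (fderiv ℝ Ginv (G (Ginv z)) c) = fderiv ℝ (fun y => u (Ginv y)) (G (Ginv z)) c := by
    refine ⟨mink_Ginv_fderiv_Ginv hz _, fun c => ?_⟩
    rw [G_Ginv hz]
    change hypMetric z _ _ = _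
    rw [hypMetric_eq hz, fderiv_eq_ip _ c]
    have he : (dd z)⁻¹ * dd z = 1 := inv_mul_cancel₀ hd.ne'
    simp only [ip, gradChart, Complex.re_ofReal_mul, Complex.im_ofReal_mul]
    simp
    field_simp
  have hs := Classical.epsilon_spec (p := fun w : Fin 3 → ℝ => mink (Ginv z) w = 0 ∧
    ∀ c : ℂ, mink w (fderiv ℝ Ginv (G (Ginv z)) c)
      = fderiv ℝ (fun y => u (Ginv y)) (G (Ginv z)) c) ⟨_, hw⟩
  change mink (Ginv z) (grad u (Ginv z)) = 0 ∧ ∀ c : ℂ, mink (grad u (Ginv z)) _ = _ at hs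
  rw [← sub_eq_zero]
  refine eq_zero_of_mink hz ?_ fun c => ?_
  · have h1 := hs.1
    have h2 := hw.1
    simp only [mink, Pi.sub_apply] at h1 h2 ⊢
    linarith
  · have h1 := hs.2 c
    have h2 := hw.2 c
    rw [← h2, G_Ginv hz] at h1
    simp only [mink, Pi.sub_apply] at h1 ⊢
    linarith

theorem GPush_grad (u : (Fin 3 → ℝ) → ℝ) {z : ℂ} (hz : z ∈ disk) :
    GPush (grad u) z = gradChart (fun y => u (Ginv y)) z := by
  rw [GPush, grad_Ginv u hz, fderiv_G_fderiv_Ginv hz]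

theorem J_grad_Ginv (u : (Fin 3 → ℝ) → ℝ) {z : ℂ} (hz : z ∈ disk) :
    J (grad u) (Ginv z) = fderiv ℝ Ginv z (Complex.I * gradChart (fun y => u (Ginv y)) z) := by
  rw [J, grad_Ginv u hz, cross_Ginv_fderiv_Ginv hz]

theorem GPush_J_grad (u : (Fin 3 → ℝ) → ℝ) {z : ℂ} (hz : z ∈ disk) :
    GPush (J (grad u)) z = Complex.I * gradChart (fun y => u (Ginv y)) z := by
  rw [GPush, J_grad_Ginv u hz, fderiv_G_fderiv_Ginv hz]

theorem mink_J (V : (Fin 3 → ℝ) → (Fin 3 → ℝ)) (p : Fin 3 → ℝ) : mink p (J V p) = 0 := by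
  simp [mink, J, cross]; ring

theorem laplacian_Ginv (u : (Fin 3 → ℝ) → ℝ) {z : ℂ} (hz : z ∈ disk) :
    laplacian u (Ginv z) =
      (fderiv ℝ (gradChart fun y => u (Ginv y)) z 1).re
      + (fderiv ℝ (gradChart fun y => u (Ginv y)) z Complex.I).im
      + 4 * (dd z)⁻¹ * ip z (gradChart (fun y => u (Ginv y)) z) := by
  have h : GPush (grad u) =ᶠ[𝓝 z] gradChart fun y => u (Ginv y) :=
    Filter.eventually_of_mem (disk_mem_nhds hz) fun y hy => GPush_grad u hy
  rw [laplacian, G_Ginv hz, covDeriv, covDeriv, h.fderiv_eq, christoffel_hypMetric hz,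
    christoffel_hypMetric hz, GPush_grad u hz]
  simp [gam, ip, -Complex.ofReal_inv]
  ring

theorem laplacian_Ginv_of_hasWirt {u : (Fin 3 → ℝ) → ℝ} {z p q : ℂ} (hz : z ∈ disk)
    (h : HasWirt (gradChart fun y => u (Ginv y)) p q z) :
    laplacian u (Ginv z) = 2 * p.re + 4 * (dd z)⁻¹ * ip z (gradChart (fun y => u (Ginv y)) z) := by
  rw [laplacian_Ginv u hz, h.fderiv_apply, h.fderiv_apply]
  simp; ring

/-- Conformal invariance in dimension two: the first-order terms cancel and a multiple of the
Euclidean Laplacian remains. This form suits the maximum principle, where `u` is only of class `C²`.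
-/
theorem laplacian_Ginv_of_differentiableAt {u : (Fin 3 → ℝ) → ℝ} {z : ℂ} (hz : z ∈ disk)
    (h1 : DifferentiableAt ℝ (fun y => fderiv ℝ (fun y => u (Ginv y)) y 1) z)
    (h2 : DifferentiableAt ℝ (fun y => fderiv ℝ (fun y => u (Ginv y)) y Complex.I) z) :
    laplacian u (Ginv z) = dd z ^ 2 / 4 *
      (fderiv ℝ (fun y => fderiv ℝ (fun y => u (Ginv y)) y 1) z 1
        + fderiv ℝ (fun y => fderiv ℝ (fun y => u (Ginv y)) y Complex.I) z Complex.I) := by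
  have hd := dd_pos hz
  rw [laplacian_Ginv u hz]
  set f : ℂ → ℝ := fun y => u (Ginv y)
  have k1 : HasFDerivAt (fun y => dd y ^ 2 / 4 * fderiv ℝ f y 1) _ z :=
    ((((hasFDerivAt_dd z).pow 2).mul_const (1 / 4 : ℝ)).congr_of_eventuallyEq
      (.of_forall fun y => div_eq_mul_one_div _ _)).mul h1.hasFDerivAt
  have k2 : HasFDerivAt (fun y => dd y ^ 2 / 4 * fderiv ℝ f y Complex.I) _ z :=
    ((((hasFDerivAt_dd z).pow 2).mul_const (1 / 4 : ℝ)).congr_of_eventuallyEq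
      (.of_forall fun y => div_eq_mul_one_div _ _)).mul h2.hasFDerivAt
  have hre : ∀ y, (gradChart f y).re = dd y ^ 2 / 4 * fderiv ℝ f y 1 := fun y => by
    rw [gradChart, Complex.re_ofReal_mul]; simp
  have him : ∀ y, (gradChart f y).im = dd y ^ 2 / 4 * fderiv ℝ f y Complex.I := fun y => by
    rw [gradChart, Complex.im_ofReal_mul]; simp
  have hW : DifferentiableAt ℝ (gradChart f) z := by
    have : gradChart f = fun y => ((dd y ^ 2 / 4 * fderiv ℝ f y 1 : ℝ) : ℂ)
        + ((dd y ^ 2 / 4 * fderiv ℝ f y Complex.I : ℝ) : ℂ) * Complex.I := by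
      funext y
      rw [← hre, ← him, Complex.re_add_im]
    rw [this]
    exact (Complex.ofRealCLM.differentiableAt.comp z k1.differentiableAt).add
      ((Complex.ofRealCLM.differentiableAt.comp z k2.differentiableAt).mul_const _)
  have e1 : (fderiv ℝ (gradChart f) z 1).re = fderiv ℝ (fun y => (gradChart f y).re) z 1 := by
    have := (Complex.reCLM.hasFDerivAt.comp z hW.hasFDerivAt).fderiv
    exact (congrArg (fun L : ℂ →L[ℝ] ℝ => L 1) this).symm
  have e2 : (fderiv ℝ (gradChart f) z Complex.I).im
      = fderiv ℝ (fun y => (gradChart f y).im) z Complex.I := by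
    have := (Complex.imCLM.hasFDerivAt.comp z hW.hasFDerivAt).fderiv
    exact (congrArg (fun L : ℂ →L[ℝ] ℝ => L Complex.I) this).symm
  rw [e1, e2, funext hre, funext him, k1.fderiv, k2.fderiv, ip, hre, him]
  simp
  field_simp
  ring

/-! ### Criteria for harmonic Lagrangian vector fields in the disk -/

/-- For real `f` the combination `∂₁f + i ∂₂f` is `2 f_z̄`. -/
theorem gradChart_eq_of_hasWirt {f : ℂ → ℝ} {z p q : ℂ}
    (h : HasWirt (fun y => (f y : ℂ)) p q z) : gradChart f z = (dd z : ℂ) ^ 2 / 2 * q := by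
  have hre : HasFDerivAt f (Complex.reCLM.comp (wirt p q)) z :=
    Complex.reCLM.hasFDerivAt.comp z h
  have him : HasFDerivAt (fun _ : ℂ => (0 : ℝ)) (Complex.imCLM.comp (wirt p q)) z :=
    Complex.imCLM.hasFDerivAt.comp z h
  have h0 := him.unique (hasFDerivAt_const (0 : ℝ) z)
  have key : ∀ a, ((fderiv ℝ f z a : ℝ) : ℂ) = p * a + q * conj a := fun a => by
    rw [hre.fderiv]
    apply Complex.ext
    · simp
    · have := congrArg (fun L : ℂ →L[ℝ] ℝ => L a) h0
      simp at this
      simp [this]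
  rw [gradChart, key, key]
  simp
  linear_combination ((dd z : ℂ) ^ 2 / 4 * (p - q)) * Complex.I_sq

/-- Since the metric is conformal, `e₂ = ± i e₁`. In traces over an orthonormal basis this kills all
terms in `a²` and `ā²`. -/
theorem sq_add_sq_eq_zero_of_orthonormal {z e₁ e₂ : ℂ} (hz : z ∈ disk)
    (h1 : hypMetric z e₁ e₁ = 1) (h2 : hypMetric z e₂ e₂ = 1) (h12 : hypMetric z e₁ e₂ = 0) :
    e₁ ^ 2 + e₂ ^ 2 = 0 := by
  have hd := dd_pos hz
  rw [hypMetric_eq hz] at h1 h2 h12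
  have h4 : 0 < 4 * (dd z)⁻¹ ^ 2 := by positivity
  have k12 : ip e₁ e₂ = 0 := (mul_eq_zero.1 h12).resolve_left h4.ne'
  have k : ip e₁ e₁ = ip e₂ e₂ := mul_left_cancel₀ h4.ne' (h1.trans h2.symm)
  have k1 : ip e₁ e₁ ≠ 0 := fun h => by simp [h] at h1
  set s := ip e₁ e₁ with hs
  set D := e₁.re * e₂.im - e₁.im * e₂.re with hD
  -- Lagrange's identity; the sign of `D` is the orientation of the basis.
  have hDs : D ^ 2 = s ^ 2 := by
    have : D ^ 2 = ip e₁ e₁ * ip e₂ e₂ - ip e₁ e₂ ^ 2 := by simp only [ip, hD]; ring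
    rw [this, k12, ← k, ← hs]; ring
  have he : (s : ℂ) * e₂ = D * (Complex.I * e₁) := by
    simp only [ip] at k12
    apply Complex.ext
    · simp [hs, hD, ip]; linear_combination e₁.re * k12
    · simp [hs, hD, ip]; linear_combination e₁.im * k12
  have hsC : (s : ℂ) ^ 2 ≠ 0 := pow_ne_zero _ (Complex.ofReal_ne_zero.2 k1)
  have hDC : (D : ℂ) ^ 2 = (s : ℂ) ^ 2 := by exact_mod_cast hDs
  refine (mul_eq_zero.1 (?_ : (s : ℂ) ^ 2 * (e₁ ^ 2 + e₂ ^ 2) = 0)).resolve_left hsC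
  linear_combination (s * e₂ + D * (Complex.I * e₁)) * he + D ^ 2 * e₁ ^ 2 * Complex.I_sq
    - e₁ ^ 2 * hDC

theorem hasFDerivAt_section {V : ℂ → ℂ} {p q z : ℂ} (h : HasWirt V p q z) :
    HasFDerivAt (fun y => (y, V y)) ((ContinuousLinearMap.id ℝ ℂ).prod (wirt p q)) z :=
  (hasFDerivAt_id z).prodMk h

/-- Only the `a ā` part of the second derivative survives the trace. Its coefficient is `2 V_zz̄ + 4
z̄ V_z̄ / dd`, so the tension vanishes when `V_zz̄ = -2 z̄ V_z̄ / dd`. Both orders of the mixed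
derivative enter as hypotheses. -/
theorem isHarmonicMapOn_section {V α β α' β' : ℂ → ℂ} (hV : ContDiffOn ℝ ∞ V disk)
    (h : ∀ z ∈ disk, HasWirt V (α z) (β z) z)
    (hα : ∀ z ∈ disk, HasWirt α (α' z) (-2 * conj z * ((dd z)⁻¹ : ℝ) * β z) z)
    (hβ : ∀ z ∈ disk, HasWirt β (-2 * conj z * ((dd z)⁻¹ : ℝ) * β z) (β' z) z) :
    IsHarmonicMapOn hypMetric GG disk fun z => (z, V z) := by
  refine ⟨contDiffOn_id.prodMk hV, fun z hz e₁ e₂ h1 h2 h12 => ?_⟩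
  have hs := sq_add_sq_eq_zero_of_orthonormal hz h1 h2 h12
  have hs' : conj e₁ ^ 2 + conj e₂ ^ 2 = 0 := by
    have := congrArg conj hs
    simpa using this
  have hfd : ∀ y ∈ disk, ∀ b, fderiv ℝ (fun z => (z, V z)) y b = (b, α y * b + β y * conj b) :=
    fun y hy b => by
      rw [(hasFDerivAt_section (h y hy)).fderiv]
      simp
  have hsd : ∀ b, fderiv ℝ (fun y => fderiv ℝ (fun z => (z, V z)) y b) z b =
      (0, α' z * b ^ 2 + 2 * (-2 * conj z * ((dd z)⁻¹ : ℝ) * β z) * (b * conj b)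
        + β' z * conj b ^ 2) := fun b => by
    have he : (fun y => fderiv ℝ (fun z => (z, V z)) y b) =ᶠ[𝓝 z]
        fun y => (b, α y * b + β y * conj b) :=
      Filter.eventually_of_mem (disk_mem_nhds hz) fun y hy => hfd y hy b
    have h3 := ((hα z hz).mul (HasWirt.const b z)).add ((hβ z hz).mul (HasWirt.const (conj b) z))
    rw [he.fderiv_eq, ((hasFDerivAt_const b z).prodMk h3).fderiv]
    simp
    ring
  simp only [secondCovDeriv, hsd, hfd z hz, christoffel_hypMetric hz]
  rw [christoffel_GG (P := (z, V z)) hz, christoffel_GG (P := (z, V z)) hz]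
  simp only [GGgam, gam]
  ext1
  · simp
  · simp only [Prod.snd_add, Prod.snd_sub, Prod.snd_zero, map_mul,
      Complex.conj_conj, Complex.conj_ofReal, map_ofNat]
    generalize ((dd z)⁻¹ : ℝ) = e
    push_cast
    linear_combination (α' z + 2 * conj (V z) * e + 4 * conj z * (e ^ 2 * ip z (V z))
      + 2 * conj z * e * α z) * hs + (β' z - β z * (2 * z * e)) * hs'

/-- Write `∇_c V = m c + q c̄`. The antilinear part cancels in `Ω`, and the linear part contributes
a multiple of `Re m`, which is half the divergence of `V`. -/
theorem Omega_section {V : ℂ → ℂ} {p q z : ℂ} (hz : z ∈ disk) (h : HasWirt V p q z)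
    (hre : (p + 2 * conj z * V z * ((dd z)⁻¹ : ℝ)).re = 0) (a b : ℂ) :
    Omega (z, V z) (fderiv ℝ (fun z => (z, V z)) z a) (fderiv ℝ (fun z => (z, V z)) z b) = 0 := by
  rw [(hasFDerivAt_section h).fderiv]
  have hv : ∀ c, verPart (z, V z) (((ContinuousLinearMap.id ℝ ℂ).prod (wirt p q)) c)
      = (p + 2 * conj z * V z * ((dd z)⁻¹ : ℝ)) * c + q * conj c := fun c => by
    simp [verPart, christoffel_hypMetric hz, gam]
    ring
  rw [Omega, hv, hv]
  simp only [hypMetric_eq hz, chartJ_eq hz, ip]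
  generalize p + 2 * conj z * V z * ((dd z)⁻¹ : ℝ) = m at hre
  simp [hre]
  ring

/-! ### Solutions of `Δu = 2u` built from a holomorphic function -/

/-- The solution `Re(z F') + (1 + |z|²)/(1 - |z|²) Re F` built from a holomorphic function `F` with
derivative `F₁`. -/
def holSol (F F₁ : ℂ → ℂ) (z : ℂ) : ℝ := (z * F₁ z).re + (2 * (dd z)⁻¹ - 1) * (F z).re

/-- The gradient of `holSol`. -/
def holGrad (F F₁ F₂ : ℂ → ℂ) (z : ℂ) : ℂ :=
  1 / 2 * (dd z * conj (F₁ z)) + 1 / 4 * (dd z ^ 2 * (conj z * conj (F₂ z))) + z * (F z).re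

theorem hasWirt_dd (z : ℂ) : HasWirt (fun y => (dd y : ℂ)) (-conj z) (-z) z := by
  have h := (HasWirt.const 1 z).add (((HasWirt.id z).mul (HasWirt.id z).conjugate).const_mul (-1))
  have he : (fun y : ℂ => (1 : ℂ) + -1 * (y * conj y)) = fun y => (dd y : ℂ) := by
    funext y; rw [ofReal_dd]; ring
  rw [he] at h
  exact h.congr_deriv (by simp) (by simp)

theorem hasWirt_ofReal_re {F : ℂ → ℂ} {p z : ℂ} (h : HasDerivAt F p z) :
    HasWirt (fun y => ((F y).re : ℂ)) (1 / 2 * p) (1 / 2 * conj p) z := by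
  have h1 := ((HasWirt.of_hasDerivAt h).add (HasWirt.of_hasDerivAt h).conjugate).const_mul (1 / 2)
  have he : (fun y : ℂ => 1 / 2 * (F y + conj (F y))) = fun y => ((F y).re : ℂ) := by
    funext y
    rw [Complex.add_conj]; push_cast; ring
  rw [he] at h1
  exact h1.congr_deriv (by simp) (by simp)

theorem dd_ne_zero {z : ℂ} (hz : z ∈ disk) : (dd z : ℂ) ≠ 0 :=
  Complex.ofReal_ne_zero.2 (dd_pos hz).ne'

section HolomorphicData

variable {F F₁ F₂ F₃ F₄ : ℂ → ℂ} {z : ℂ}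

theorem gradChart_holSol (hz : z ∈ disk) (h0 : HasDerivAt F (F₁ z) z)
    (h1 : HasDerivAt F₁ (F₂ z) z) : gradChart (holSol F F₁) z = holGrad F F₁ F₂ z := by
  have hd := dd_ne_zero hz
  have h := (hasWirt_ofReal_re ((hasDerivAt_id z).fun_mul h1)).add
    (((((hasWirt_dd z).inv hd).const_mul 2).add (HasWirt.const (-1) z)).mul (hasWirt_ofReal_re h0))
  have he : (fun y => (((id y * F₁ y).re : ℝ) : ℂ) + (2 * ((dd y : ℂ))⁻¹ + -1) * ((F y).re : ℂ))
      = fun y => (holSol F F₁ y : ℂ) := by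
    funext y; simp only [holSol, id]; push_cast; ring
  rw [he] at h
  rw [gradChart_eq_of_hasWirt h, holGrad]
  simp
  field_simp
  rw [ofReal_dd]
  ring

theorem hasWirt_holGrad (h0 : HasDerivAt F (F₁ z) z)
    (h1 : HasDerivAt F₁ (F₂ z) z) (h2 : HasDerivAt F₂ (F₃ z) z) :
    HasWirt (holGrad F F₁ F₂)
      (-1 / 2 * (conj z * conj (F₁ z)) + -1 / 2 * (dd z * (conj z * (conj z * conj (F₂ z))))
        + (F z).re + 1 / 2 * (z * F₁ z))
      (1 / 4 * (dd z ^ 2 * conj (3 * F₂ z + z * F₃ z))) z := by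
  have w1 := (HasWirt.of_hasDerivAt h1).conjugate
  have w2 := (HasWirt.of_hasDerivAt h2).conjugate
  have wd := hasWirt_dd z
  have h := (((wd.mul w1).const_mul (1 / 2)).add
    (((wd.mul wd).mul ((HasWirt.id z).conjugate.mul w2)).const_mul (1 / 4))).add
    ((HasWirt.id z).mul (hasWirt_ofReal_re h0))
  simp only [← pow_two] at h
  refine h.congr_deriv ?_ ?_
  · simp
    ring
  · simp [map_ofNat]
    rw [ofReal_dd]
    ring

/-- The left side is the complex-linear part of `∇ grad u`. That it equals the real number `u`
yields both `Δu = 2u` and the Lagrangian condition for `J grad u`. -/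
theorem holGrad_add_gam (hz : z ∈ disk) :
    (-1 / 2 * (conj z * conj (F₁ z)) + -1 / 2 * (dd z * (conj z * (conj z * conj (F₂ z))))
        + (F z).re + 1 / 2 * (z * F₁ z)) + 2 * conj z * holGrad F F₁ F₂ z * ((dd z)⁻¹ : ℝ)
      = holSol F F₁ z := by
  have hd := dd_ne_zero hz
  have hre : ((z * F₁ z).re : ℂ) = 1 / 2 * (z * F₁ z + conj z * conj (F₁ z)) := by
    rw [← map_mul, Complex.add_conj]; push_cast; ring
  rw [holGrad, holSol]
  push_cast
  rw [hre]
  field_simp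
  rw [ofReal_dd]
  ring

/-- Together with `hasWirt_holGrad_zbar` this supplies the mixed derivative required by
`isHarmonicMapOn_section`; the other second derivatives are irrelevant and stay existential. -/
theorem hasWirt_holGrad_z (hz : z ∈ disk) (h0 : HasDerivAt F (F₁ z) z)
    (h1 : HasDerivAt F₁ (F₂ z) z) (h2 : HasDerivAt F₂ (F₃ z) z) :
    ∃ p, HasWirt (fun z => -1 / 2 * (conj z * conj (F₁ z))
        + -1 / 2 * (dd z * (conj z * (conj z * conj (F₂ z)))) + (F z).re + 1 / 2 * (z * F₁ z))
      p (-2 * conj z * ((dd z)⁻¹ : ℝ) * (1 / 4 * (dd z ^ 2 * conj (3 * F₂ z + z * F₃ z)))) z := by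
  have hd := dd_ne_zero hz
  have wc := (HasWirt.id z).conjugate
  have w1 := (HasWirt.of_hasDerivAt h1).conjugate
  have w2 := (HasWirt.of_hasDerivAt h2).conjugate
  have h := ((((wc.mul w1).const_mul (-1 / 2)).add
    (((hasWirt_dd z).mul (wc.mul (wc.mul w2))).const_mul (-1 / 2))).add (hasWirt_ofReal_re h0)).add
    (((HasWirt.id z).mul (HasWirt.of_hasDerivAt h1)).const_mul (1 / 2))
  refine ⟨_, h.congr_deriv rfl ?_⟩
  simp [map_ofNat]
  field_simp
  rw [ofReal_dd]
  ring

theorem hasWirt_holGrad_zbar (hz : z ∈ disk) (h2 : HasDerivAt F₂ (F₃ z) z)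
    (h3 : HasDerivAt F₃ (F₄ z) z) :
    ∃ q, HasWirt (fun z => 1 / 4 * (dd z ^ 2 * conj (3 * F₂ z + z * F₃ z)))
      (-2 * conj z * ((dd z)⁻¹ : ℝ) * (1 / 4 * (dd z ^ 2 * conj (3 * F₂ z + z * F₃ z)))) q z := by
  have hd := dd_ne_zero hz
  have w2 := HasWirt.of_hasDerivAt h2
  have w3 := HasWirt.of_hasDerivAt h3
  have h := (((hasWirt_dd z).mul (hasWirt_dd z)).mul
    ((w2.const_mul 3).add ((HasWirt.id z).mul w3)).conjugate).const_mul (1 / 4)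
  simp only [← pow_two] at h
  refine ⟨_, h.congr_deriv ?_ rfl⟩
  simp
  field_simp
  ring

theorem laplacian_of_holSol {u : (Fin 3 → ℝ) → ℝ} (hu : ∀ z ∈ disk, u (Ginv z) = holSol F F₁ z)
    (h0 : ∀ z ∈ disk, HasDerivAt F (F₁ z) z) (h1 : ∀ z ∈ disk, HasDerivAt F₁ (F₂ z) z)
    (h2 : ∀ z ∈ disk, HasDerivAt F₂ (F₃ z) z) (hz : z ∈ disk) :
    laplacian u (Ginv z) = 2 * u (Ginv z) := by
  have hg : ∀ y ∈ disk, gradChart (fun y => u (Ginv y)) y = holGrad F F₁ F₂ y := fun y hy => by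
    rw [← gradChart_holSol hy (h0 y hy) (h1 y hy)]
    have : (fun y => u (Ginv y)) =ᶠ[𝓝 y] holSol F F₁ :=
      Filter.eventually_of_mem (disk_mem_nhds hy) hu
    rw [gradChart, gradChart, this.fderiv_eq]
  have hW : HasWirt (gradChart fun y => u (Ginv y)) _ _ z :=
    HasFDerivAt.congr_of_eventuallyEq (hasWirt_holGrad (h0 z hz) (h1 z hz) (h2 z hz))
      (Filter.eventually_of_mem (disk_mem_nhds hz) hg)
  rw [laplacian_Ginv_of_hasWirt hz hW, hg z hz, hu z hz]
  have := congrArg Complex.re (holGrad_add_gam (F := F) (F₁ := F₁) (F₂ := F₂) hz)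
  rw [Complex.ofReal_re, Complex.add_re] at this
  rw [← this]
  simp only [ip]
  generalize holGrad F F₁ F₂ z = W
  simp [-Complex.ofReal_inv]
  ring

theorem GPush_J_grad_of_holSol {u : (Fin 3 → ℝ) → ℝ}
    (hu : ∀ z ∈ disk, u (Ginv z) = holSol F F₁ z)
    (h0 : ∀ z ∈ disk, HasDerivAt F (F₁ z) z) (h1 : ∀ z ∈ disk, HasDerivAt F₁ (F₂ z) z)
    (hz : z ∈ disk) : GPush (J (grad u)) z = Complex.I * holGrad F F₁ F₂ z := by
  rw [GPush_J_grad u hz, ← gradChart_holSol hz (h0 z hz) (h1 z hz)]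
  have : (fun y => u (Ginv y)) =ᶠ[𝓝 z] holSol F F₁ :=
    Filter.eventually_of_mem (disk_mem_nhds hz) hu
  rw [gradChart, gradChart, this.fderiv_eq]

theorem contDiffOn_of_hasDerivAt (h : ∀ z ∈ disk, HasDerivAt F (F₁ z) z) :
    ContDiffOn ℝ ∞ F disk := by
  have : DifferentiableOn ℂ F disk := fun z hz => (h z hz).differentiableAt.differentiableWithinAt
  exact (this.contDiffOn isOpen_disk).restrict_scalars ℝ

theorem contDiff_dd : ContDiff ℝ ∞ dd :=
  contDiff_const.sub ((Complex.reCLM.contDiff.mul Complex.reCLM.contDiff).add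
    (Complex.imCLM.contDiff.mul Complex.imCLM.contDiff))

theorem contDiffOn_holSol (h0 : ∀ z ∈ disk, HasDerivAt F (F₁ z) z)
    (h1 : ∀ z ∈ disk, HasDerivAt F₁ (F₂ z) z) : ContDiffOn ℝ ∞ (holSol F F₁) disk := by
  have hi : ContDiffOn ℝ ∞ (fun z => (dd z)⁻¹) disk :=
    contDiff_dd.contDiffOn.inv fun z hz => (dd_pos hz).ne'
  exact (Complex.reCLM.contDiff.comp_contDiffOn
    (contDiffOn_id.mul (contDiffOn_of_hasDerivAt h1))).add
    (((contDiffOn_const.mul hi).sub contDiffOn_const).mul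
      (Complex.reCLM.contDiff.comp_contDiffOn (contDiffOn_of_hasDerivAt h0)))

theorem contDiffOn_holGrad (h0 : ∀ z ∈ disk, HasDerivAt F (F₁ z) z)
    (h1 : ∀ z ∈ disk, HasDerivAt F₁ (F₂ z) z) (h2 : ∀ z ∈ disk, HasDerivAt F₂ (F₃ z) z) :
    ContDiffOn ℝ ∞ (holGrad F F₁ F₂) disk := by
  have hd : ContDiffOn ℝ ∞ (fun z => (dd z : ℂ)) disk :=
    (Complex.ofRealCLM.contDiff.comp contDiff_dd).contDiffOn
  have hc : ContDiff ℝ ∞ (fun z : ℂ => conj z) := Complex.conjCLE.contDiff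
  have hr : ContDiffOn ℝ ∞ (fun z => ((F z).re : ℂ)) disk :=
    (Complex.ofRealCLM.contDiff.comp Complex.reCLM.contDiff).comp_contDiffOn
      (contDiffOn_of_hasDerivAt h0)
  exact ((contDiffOn_const.mul (hd.mul (hc.comp_contDiffOn (contDiffOn_of_hasDerivAt h1)))).add
    (contDiffOn_const.mul ((hd.pow 2).mul
      (hc.contDiffOn.mul (hc.comp_contDiffOn (contDiffOn_of_hasDerivAt h2)))))).add
    (contDiffOn_id.mul hr)

theorem IsHarmonicMapOn.congr {g : ℂ → ℂ → ℂ → ℝ} {g' : ℂ × ℂ → ℂ × ℂ → ℂ × ℂ → ℝ} {U : Set ℂ}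
    {S T : ℂ → ℂ × ℂ} (hU : IsOpen U) (hS : IsHarmonicMapOn g g' U S) (h : Set.EqOn T S U) :
    IsHarmonicMapOn g g' U T := by
  refine ⟨hS.1.congr h, fun x hx e₁ e₂ h1 h2 h12 => ?_⟩
  have hE : ∀ y ∈ U, fderiv ℝ T y = fderiv ℝ S y := fun y hy =>
    Filter.EventuallyEq.fderiv_eq (Filter.eventually_of_mem (hU.mem_nhds hy) h)
  have hE2 : ∀ b, fderiv ℝ (fun y => fderiv ℝ T y b) x = fderiv ℝ (fun y => fderiv ℝ S y b) x :=
    fun b => Filter.EventuallyEq.fderiv_eq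
      (Filter.eventually_of_mem (hU.mem_nhds hx) fun y hy => by simp only [hE y hy])
  have := hS.2 x hx e₁ e₂ h1 h2 h12
  simp only [secondCovDeriv] at this ⊢
  rw [hE2, hE2, hE x hx, h hx]
  exact this

theorem isHarmonicLagrangian_of_holSol {u : (Fin 3 → ℝ) → ℝ}
    (hu : ∀ z ∈ disk, u (Ginv z) = holSol F F₁ z)
    (h0 : ∀ z ∈ disk, HasDerivAt F (F₁ z) z) (h1 : ∀ z ∈ disk, HasDerivAt F₁ (F₂ z) z)
    (h2 : ∀ z ∈ disk, HasDerivAt F₂ (F₃ z) z) (h3 : ∀ z ∈ disk, HasDerivAt F₃ (F₄ z) z) :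
    IsHarmonicLagrangian (J (grad u)) := by
  classical
  have hV : Set.EqOn (sectionMap (J (grad u))) (fun z => (z, Complex.I * holGrad F F₁ F₂ z))
      disk := fun z hz => by
    simp only [sectionMap]
    rw [GPush_J_grad_of_holSol hu h0 h1 hz]
  have w : ∀ z ∈ disk, _ := fun z hz =>
    (hasWirt_holGrad (h0 z hz) (h1 z hz) (h2 z hz)).const_mul Complex.I
  -- The implication sits under the existential so that `choose` gives functions on all of `ℂ`; the
  -- value 0 off the disk is a dummy.
  have wz : ∀ z : ℂ, ∃ p, z ∈ disk → _ := fun z =>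
    if hz : z ∈ disk then
      (hasWirt_holGrad_z hz (h0 z hz) (h1 z hz) (h2 z hz)).imp fun p hp _ => hp
    else ⟨0, fun h => (hz h).elim⟩
  have wb : ∀ z : ℂ, ∃ p, z ∈ disk → _ := fun z =>
    if hz : z ∈ disk then
      (hasWirt_holGrad_zbar hz (h2 z hz) (h3 z hz)).imp fun p hp _ => hp
    else ⟨0, fun h => (hz h).elim⟩
  choose p hp using wz
  choose q hq using wb
  refine ⟨fun x _ => mink_J _ x, IsHarmonicMapOn.congr isOpen_disk
    (isHarmonicMapOn_section (contDiffOn_const.mul (contDiffOn_holGrad h0 h1 h2)) w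
      (fun z hz => ((hp z hz).const_mul Complex.I).congr_deriv rfl (by ring))
      (fun z hz => ((hq z hz).const_mul Complex.I).congr_deriv (by ring) rfl)) hV,
    fun z hz a b => ?_⟩
  rw [Filter.EventuallyEq.fderiv_eq (Filter.eventually_of_mem (disk_mem_nhds hz) hV), hV hz]
  refine Omega_section (V := fun z => Complex.I * holGrad F F₁ F₂ z) hz (w z hz) ?_ a b
  -- Multiplication by `i` turns the complex-linear part `u` into `i u`, which has real part zero.
  have := holGrad_add_gam (F := F) (F₁ := F₁) (F₂ := F₂) hz
  rw [show ∀ m W d : ℂ, Complex.I * m + 2 * conj z * (Complex.I * W) * d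
    = Complex.I * (m + 2 * conj z * W * d) by intros; ring, this]
  simp

end HolomorphicData

/-! ### Cauchy integrals over the unit circle -/

theorem norm_lt_one {z : ℂ} (hz : z ∈ disk) : ‖z‖ < 1 := by simpa [disk] using hz

theorem norm_eq_one {ζ : ℂ} (hζ : ζ ∈ Metric.sphere (0 : ℂ) 1) : ‖ζ‖ = 1 := by simpa using hζ

theorem mul_conj_eq_one {ζ : ℂ} (hζ : ζ ∈ Metric.sphere (0 : ℂ) 1) : ζ * conj ζ = 1 := by
  rw [Complex.mul_conj, Complex.normSq_eq_norm_sq, norm_eq_one hζ]; simp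

theorem one_sub_norm_le {z ζ : ℂ} (hζ : ζ ∈ Metric.sphere (0 : ℂ) 1) :
    1 - ‖z‖ ≤ ‖1 - z * conj ζ‖ := by
  have h := norm_sub_norm_le (1 : ℂ) (z * conj ζ)
  simpa [norm_eq_one hζ] using h

theorem one_sub_mul_conj_ne_zero {z ζ : ℂ} (hz : z ∈ disk) (hζ : ζ ∈ Metric.sphere (0 : ℂ) 1) :
    1 - z * conj ζ ≠ 0 := fun h => by
  have := one_sub_norm_le (z := z) hζ
  rw [h, norm_zero] at this
  linarith [norm_lt_one hz]

theorem continuousOn_kernel {z : ℂ} (hz : z ∈ disk) :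
    ContinuousOn (fun ζ : ℂ => (1 - z * conj ζ)⁻¹) (Metric.sphere 0 1) :=
  ContinuousOn.inv₀ (by fun_prop) fun _ hζ => one_sub_mul_conj_ne_zero hz hζ

theorem circleIntegrable_of_continuousOn {E : Type*} [NormedAddCommGroup E] {f : ℂ → E}
    (hf : ContinuousOn f (Metric.sphere 0 1)) : CircleIntegrable f 0 1 :=
  hf.circleIntegrable zero_le_one

/-- The maps are only real-linear because `holSol` and `holGrad` involve real parts and conjugates.
The lemma transfers pointwise kernel identities to averages. -/
theorem circleAverage_lin_comb {E : Type*} [NormedAddCommGroup E] [NormedSpace ℝ E]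
    [CompleteSpace E] (L₁ L₂ L₃ : ℂ →L[ℝ] E) {f₁ f₂ f₃ : ℂ → ℂ}
    (h₁ : ContinuousOn f₁ (Metric.sphere 0 1)) (h₂ : ContinuousOn f₂ (Metric.sphere 0 1))
    (h₃ : ContinuousOn f₃ (Metric.sphere 0 1)) {f : ℂ → E}
    (hf : Set.EqOn f (fun ζ => L₁ (f₁ ζ) + L₂ (f₂ ζ) + L₃ (f₃ ζ)) (Metric.sphere 0 1)) :
    Real.circleAverage f 0 1 = L₁ (Real.circleAverage f₁ 0 1) + L₂ (Real.circleAverage f₂ 0 1)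
      + L₃ (Real.circleAverage f₃ 0 1) := by
  have c : ∀ (L : ℂ →L[ℝ] E) {g : ℂ → ℂ}, ContinuousOn g (Metric.sphere 0 1) →
      CircleIntegrable (fun ζ => L (g ζ)) 0 1 := fun L g hg =>
    circleIntegrable_of_continuousOn (L.continuous.comp_continuousOn hg)
  rw [← L₁.circleAverage_comp_comm (circleIntegrable_of_continuousOn h₁),
    ← L₂.circleAverage_comp_comm (circleIntegrable_of_continuousOn h₂),
    ← L₃.circleAverage_comp_comm (circleIntegrable_of_continuousOn h₃),
    Real.circleAverage_congr_sphere (f₁ := f) (by simpa using hf)]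
  refine (Real.circleAverage_add ((c L₁ h₁).add (c L₂ h₂)) (c L₃ h₃)).trans ?_
  rw [Real.circleAverage_add (c L₁ h₁) (c L₂ h₂)]
  rfl

theorem norm_circleAverage_le {E : Type*} [NormedAddCommGroup E] [NormedSpace ℝ E] (f : ℂ → E) :
    ‖Real.circleAverage f 0 1‖ ≤ Real.circleAverage (fun ζ => ‖f ζ‖) 0 1 := by
  rw [Real.circleAverage_def, Real.circleAverage_def, norm_smul, smul_eq_mul, Real.norm_eq_abs,
    abs_of_pos (by positivity)]
  gcongr
  exact intervalIntegral.norm_integral_le_integral_norm (by positivity)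

/-- The average over the unit circle of `φ(ζ) ζ̄ᵏ (1 - z ζ̄)⁻ᵏ⁻¹`. -/
def cau (φ : ℂ → ℝ) (k : ℕ) (z : ℂ) : ℂ :=
  Real.circleAverage (fun ζ => (φ ζ : ℂ) * conj ζ ^ k * (1 - z * conj ζ)⁻¹ ^ (k + 1)) 0 1

variable {φ : ℂ → ℝ}

theorem continuousOn_cau (hφ : ContinuousOn φ (Metric.sphere 0 1)) (k : ℕ) {z : ℂ}
    (hz : z ∈ disk) : ContinuousOn
      (fun ζ => (φ ζ : ℂ) * conj ζ ^ k * (1 - z * conj ζ)⁻¹ ^ (k + 1)) (Metric.sphere 0 1) :=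
  ((Complex.continuous_ofReal.comp_continuousOn hφ).mul
    (Complex.continuous_conj.continuousOn.pow k)).mul ((continuousOn_kernel hz).pow _)

theorem hasDerivAt_cau (hφ : ContinuousOn φ (Metric.sphere 0 1)) (k : ℕ) {z : ℂ}
    (hz : z ∈ disk) : HasDerivAt (cau φ k) ((k + 1) * cau φ (k + 1) z) z := by
  obtain ⟨C, hC⟩ := (isCompact_sphere (0 : ℂ) 1).exists_bound_of_continuousOn hφ
  have hz1 := norm_lt_one hz
  -- Any radius strictly between `‖z‖` and 1 serves: on that ball the kernel is bounded by `(1 -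
  -- ρ)⁻¹`, uniformly in the circle point.
  set ρ := (1 + ‖z‖) / 2 with hρ
  have hρ1 : 0 < 1 - ρ := by rw [hρ]; linarith
  have hs : Metric.ball (0 : ℂ) ρ ∈ 𝓝 z :=
    Metric.isOpen_ball.mem_nhds (by simp [hρ]; linarith)
  have hsub : Metric.ball (0 : ℂ) ρ ⊆ disk := Metric.ball_subset_ball (by linarith)
  have hcirc : ∀ θ : ℝ, circleMap 0 1 θ ∈ Metric.sphere (0 : ℂ) 1 :=
    fun θ => circleMap_mem_sphere _ zero_le_one _
  have hcont : ∀ (k : ℕ) {y : ℂ}, y ∈ disk → Continuous fun θ : ℝ => (φ (circleMap 0 1 θ) : ℂ) *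
      conj (circleMap 0 1 θ) ^ k * (1 - y * conj (circleMap 0 1 θ))⁻¹ ^ (k + 1) := fun k y hy =>
    (continuousOn_cau hφ k hy).comp_continuous (continuous_circleMap 0 1) hcirc
  have key := (intervalIntegral.hasDerivAt_integral_of_dominated_loc_of_deriv_le
    (μ := MeasureTheory.volume) (a := 0) (b := 2 * Real.pi)
    (F := fun y θ => (φ (circleMap 0 1 θ) : ℂ) *
      conj (circleMap 0 1 θ) ^ k * (1 - y * conj (circleMap 0 1 θ))⁻¹ ^ (k + 1))
    (F' := fun y θ => (k + 1) * ((φ (circleMap 0 1 θ) : ℂ) *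
      conj (circleMap 0 1 θ) ^ (k + 1) * (1 - y * conj (circleMap 0 1 θ))⁻¹ ^ (k + 1 + 1)))
    (bound := fun _ => (k + 1) * (C * (1 - ρ)⁻¹ ^ (k + 1 + 1))) (x₀ := z) hs
    (Filter.eventually_of_mem (disk_mem_nhds hz) fun y hy => (hcont k hy).aestronglyMeasurable)
    ((hcont k hz).intervalIntegrable _ _)
    (continuous_const.mul (hcont (k + 1) hz)).aestronglyMeasurable
    (.of_forall fun θ _ y hy => ?_) intervalIntegrable_const
    (.of_forall fun θ _ y hy => ?_)).2
  · have h2 := key.const_smul ((2 * Real.pi)⁻¹ : ℝ)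
    refine (h2.congr_deriv ?_)
    rw [intervalIntegral.integral_const_mul, cau, Real.circleAverage_def, mul_smul_comm]
  · have h1 : 1 - ρ ≤ ‖1 - y * conj (circleMap 0 1 θ)‖ := by
      have : ‖y‖ < ρ := by simpa using hy
      linarith [one_sub_norm_le (z := y) (hcirc θ)]
    have h2 := hC _ (hcirc θ)
    have h3 : ‖(k + 1 : ℂ)‖ = k + 1 := by
      rw [← Nat.cast_succ, Complex.norm_natCast]; simp
    rw [norm_mul, h3, norm_mul, norm_mul, norm_pow, norm_pow, norm_inv, RCLike.norm_conj,
      norm_eq_one (hcirc θ), Complex.norm_real]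
    simp only [one_pow, mul_one]
    have h0 : 0 ≤ C := (norm_nonneg _).trans h2
    gcongr
  · have hne := one_sub_mul_conj_ne_zero (hsub hy) (hcirc θ)
    have h1 : HasDerivAt (fun y : ℂ => 1 - y * conj (circleMap 0 1 θ))
        (-(1 * conj (circleMap 0 1 θ))) y :=
      ((hasDerivAt_id y).mul_const _).const_sub 1
    refine (((h1.inv hne).pow (k + 1)).const_mul _).congr_deriv ?_
    simp only [Pi.inv_apply, Nat.add_sub_cancel, div_eq_mul_inv, ← inv_pow]
    push_cast
    ring

/-- The conjugate of the integrand is holomorphic in `ζ` on the closed disk, so its average is its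
value at 0. -/
theorem cau_one (k : ℕ) {z : ℂ} (hz : z ∈ disk) : cau (fun _ => 1) k z = 0 ^ k := by
  have hne : ∀ ζ ∈ Metric.closedBall (0 : ℂ) 1, 1 - conj z * ζ ≠ 0 := fun ζ hζ h => by
    have h1 : ‖conj z * ζ‖ < 1 := by
      rw [norm_mul, RCLike.norm_conj]
      have : ‖ζ‖ ≤ 1 := by simpa using hζ
      nlinarith [norm_lt_one hz, norm_nonneg z, norm_nonneg ζ]
    rw [← sub_eq_zero.1 h] at h1
    simp at h1
  have hd : DifferentiableOn ℂ (fun ζ => ζ ^ k * (1 - conj z * ζ)⁻¹ ^ (k + 1))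
      (Metric.closedBall 0 1) := by
    refine (differentiableOn_id.pow k).mul (DifferentiableOn.pow (DifferentiableOn.inv ?_ hne) _)
    fun_prop
  have hcl : DiffContOnCl ℂ (fun ζ => ζ ^ k * (1 - conj z * ζ)⁻¹ ^ (k + 1))
      (Metric.ball 0 |(1 : ℝ)|) := by
    refine DifferentiableOn.diffContOnCl (hd.mono ?_)
    rw [abs_one]
    exact Metric.closure_ball_subset_closedBall
  have h := hcl.circleAverage
  have hi : CircleIntegrable (fun ζ => ζ ^ k * (1 - conj z * ζ)⁻¹ ^ (k + 1)) 0 1 :=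
    circleIntegrable_of_continuousOn (hd.continuousOn.mono Metric.sphere_subset_closedBall)
  have h2 := (Complex.conjCLE : ℂ →L[ℝ] ℂ).circleAverage_comp_comm hi
  rw [h] at h2
  rw [cau]
  convert h2 using 1
  · congr 1
    funext ζ
    simp
  · simp

/-! ### The integral representation of the solution -/

/-- The Herglotz integral of `φ`, a holomorphic function whose real part is the Poisson integral. -/
def herglotz (φ : ℂ → ℝ) (z : ℂ) : ℂ := 2 * cau φ 0 z - cau φ 0 0

/-- The solution with boundary value `φ`, in the Poincaré disk. -/
def diskSol (φ : ℂ → ℝ) : ℂ → ℝ := holSol (herglotz φ) fun z => 2 * cau φ 1 z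

/-- The gradient of `diskSol φ`. -/
def diskGrad (φ : ℂ → ℝ) : ℂ → ℂ :=
  holGrad (herglotz φ) (fun z => 2 * cau φ 1 z) fun z => 4 * cau φ 2 z

theorem hasDerivAt_herglotz (hφ : ContinuousOn φ (Metric.sphere 0 1)) {z : ℂ} (hz : z ∈ disk) :
    HasDerivAt (herglotz φ) (2 * cau φ 1 z) z := by
  refine (((hasDerivAt_cau hφ 0 hz).const_mul 2).sub_const _).congr_deriv ?_
  simp

theorem hasDerivAt_const_mul_cau (hφ : ContinuousOn φ (Metric.sphere 0 1)) (k : ℕ) {c c' : ℂ}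
    (hc : c * (k + 1) = c') {z : ℂ} (hz : z ∈ disk) :
    HasDerivAt (fun z => c * cau φ k z) (c' * cau φ (k + 1) z) z :=
  ((hasDerivAt_cau hφ k hz).const_mul c).congr_deriv (by rw [← hc]; ring)

/-- The Poisson kernel of the unit disk. -/
def pker (z ζ : ℂ) : ℝ := dd z * Complex.normSq (1 - z * conj ζ)⁻¹

theorem continuousOn_pker {z : ℂ} (hz : z ∈ disk) :
    ContinuousOn (pker z) (Metric.sphere 0 1) :=
  continuousOn_const.mul (Complex.continuous_normSq.comp_continuousOn (continuousOn_kernel hz))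

theorem ofReal_pker (z ζ : ℂ) :
    (pker z ζ : ℂ) = dd z * ((1 - z * conj ζ)⁻¹ * (1 - conj z * ζ)⁻¹) := by
  rw [pker, Complex.ofReal_mul, ← Complex.mul_conj]
  simp

theorem one_sub_conj_mul_ne_zero {z ζ : ℂ} (hz : z ∈ disk) (hζ : ζ ∈ Metric.sphere (0 : ℂ) 1) :
    1 - conj z * ζ ≠ 0 := fun h => one_sub_mul_conj_ne_zero hz hζ (by
  have := congrArg conj h
  simpa using this)

theorem ofReal_re_eq (w : ℂ) : (w.re : ℂ) = 1 / 2 * (w + conj w) := by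
  rw [Complex.add_conj]; push_cast; ring

/-- The Herglotz kernel `(1 + z ζ̄)/(1 - z ζ̄)` is `2/(1 - z ζ̄) - 1`. -/
theorem re_herglotz_kernel {z ζ : ℂ} (hz : z ∈ disk) (hζ : ζ ∈ Metric.sphere (0 : ℂ) 1) :
    2 * ((1 - z * conj ζ)⁻¹).re - 1 = pker z ζ := by
  have h1 := one_sub_mul_conj_ne_zero hz hζ
  have h2 := one_sub_conj_mul_ne_zero hz hζ
  have h3 := mul_conj_eq_one hζ
  rw [← Complex.ofReal_inj]
  rw [Complex.ofReal_sub, Complex.ofReal_mul, ofReal_re_eq, ofReal_pker, ofReal_dd]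
  simp
  field_simp
  linear_combination (-(z * conj z)) * h3

/-- This is `holSol` of the Herglotz kernel, that is, the solution for a point mass at `ζ`;
`diskGrad_kernel` is its gradient. -/
theorem diskSol_kernel {z ζ : ℂ} (hz : z ∈ disk) (hζ : ζ ∈ Metric.sphere (0 : ℂ) 1) :
    (z * (2 * (conj ζ * (1 - z * conj ζ)⁻¹ ^ 2))).re + (2 * (dd z)⁻¹ - 1) * pker z ζ
      = pker z ζ ^ 2 := by
  have h1 := one_sub_mul_conj_ne_zero hz hζ
  have h2 := one_sub_conj_mul_ne_zero hz hζ
  have h3 := mul_conj_eq_one hζ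
  have hd := dd_ne_zero hz
  rw [← Complex.ofReal_inj]
  push_cast
  rw [ofReal_re_eq, ofReal_pker]
  simp [map_ofNat]
  field_simp
  rw [ofReal_dd]
  generalize conj ζ = ξ at *
  generalize conj z = w at *
  linear_combination
    (-(1 - z * ξ) * (1 - w * ζ) * z * w - 2 * z * w + z ^ 2 * w ^ 2 * (ζ * ξ + 1)) * h3

theorem diskGrad_kernel {z ζ : ℂ} (hz : z ∈ disk) (hζ : ζ ∈ Metric.sphere (0 : ℂ) 1) :
    dd z * (ζ * (1 - conj z * ζ)⁻¹ ^ 2) + dd z ^ 2 * (conj z * (ζ ^ 2 * (1 - conj z * ζ)⁻¹ ^ 3))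
      + z * pker z ζ = dd z ^ 3 * ζ * (1 - conj z * ζ)⁻¹ ^ 3 * (1 - z * conj ζ)⁻¹ := by
  have h1 := one_sub_mul_conj_ne_zero hz hζ
  have h2 := one_sub_conj_mul_ne_zero hz hζ
  have h3 := mul_conj_eq_one hζ
  have h2' : 1 - ζ * conj z ≠ 0 := by rwa [mul_comm]
  have hd := dd_ne_zero hz
  rw [ofReal_pker]
  field_simp
  rw [ofReal_dd]
  generalize conj ζ = ξ at *
  generalize conj z = w at *
  linear_combination (-z * (1 - ζ * w + (1 - z * w) * ζ * w)) * h3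

theorem diskSol_eq (hφ : ContinuousOn φ (Metric.sphere 0 1)) {z : ℂ} (hz : z ∈ disk) :
    diskSol φ z = Real.circleAverage (fun ζ => φ ζ * pker z ζ ^ 2) 0 1 := by
  have h00 : (0 : ℂ) ∈ disk := by simp [disk]
  have := circleAverage_lin_comb (Complex.reCLM.comp ((z * 2) • ContinuousLinearMap.id ℝ ℂ))
    ((2 * (2 * (dd z)⁻¹ - 1)) • Complex.reCLM) ((-(2 * (dd z)⁻¹ - 1)) • Complex.reCLM)
    (continuousOn_cau hφ 1 hz) (continuousOn_cau hφ 0 hz) (continuousOn_cau hφ 0 h00)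
    (f := fun ζ => φ ζ * pker z ζ ^ 2) (fun ζ hζ => ?_)
  · rw [this]
    change _ = Complex.re ((z * 2) * cau φ 1 z) + (2 * (2 * (dd z)⁻¹ - 1)) * (cau φ 0 z).re
      + (-(2 * (dd z)⁻¹ - 1)) * (cau φ 0 0).re
    simp only [diskSol, holSol, herglotz]
    rw [← mul_assoc]
    simp [Complex.sub_re]
    ring
  · dsimp only
    rw [← diskSol_kernel hz hζ, ← re_herglotz_kernel hz hζ]
    have e1 : z * 2 * (φ ζ * conj ζ ^ 1 * (1 - z * conj ζ)⁻¹ ^ (1 + 1))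
      = (φ ζ : ℂ) * (z * (2 * (conj ζ * (1 - z * conj ζ)⁻¹ ^ 2))) := by ring
    have e2 : (φ ζ : ℂ) * conj ζ ^ 0 * (1 - z * conj ζ)⁻¹ ^ (0 + 1)
      = φ ζ * (1 - z * conj ζ)⁻¹ := by ring
    simp only [ContinuousLinearMap.comp_apply, smul_apply,
      ContinuousLinearMap.id_apply, smul_eq_mul, Complex.reCLM_apply, e1, e2,
      Complex.re_ofReal_mul]
    simp
    ring

theorem diskGrad_eq (hφ : ContinuousOn φ (Metric.sphere 0 1)) {z : ℂ} (hz : z ∈ disk) :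
    diskGrad φ z = Real.circleAverage (fun ζ => (φ ζ : ℂ) *
      (dd z ^ 3 * ζ * (1 - conj z * ζ)⁻¹ ^ 3 * (1 - z * conj ζ)⁻¹)) 0 1 := by
  have h00 : (0 : ℂ) ∈ disk := by simp [disk]
  have hF : ContinuousOn (fun ζ => 2 * ((φ ζ : ℂ) * conj ζ ^ 0 * (1 - z * conj ζ)⁻¹ ^ (0 + 1))
      - ((φ ζ : ℂ) * conj ζ ^ 0 * (1 - 0 * conj ζ)⁻¹ ^ (0 + 1))) (Metric.sphere 0 1) :=
    (continuousOn_const.mul (continuousOn_cau hφ 0 hz)).sub (continuousOn_cau hφ 0 h00)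
  have hh : herglotz φ z = Real.circleAverage (fun ζ =>
      2 * ((φ ζ : ℂ) * conj ζ ^ 0 * (1 - z * conj ζ)⁻¹ ^ (0 + 1))
      - ((φ ζ : ℂ) * conj ζ ^ 0 * (1 - 0 * conj ζ)⁻¹ ^ (0 + 1))) 0 1 := by
    have := circleAverage_lin_comb ((2 : ℂ) • ContinuousLinearMap.id ℝ ℂ)
      (-(ContinuousLinearMap.id ℝ ℂ)) 0 (continuousOn_cau hφ 0 hz) (continuousOn_cau hφ 0 h00)
      (continuousOn_cau hφ 0 hz) (f := fun ζ =>
      2 * ((φ ζ : ℂ) * conj ζ ^ 0 * (1 - z * conj ζ)⁻¹ ^ (0 + 1))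
      - ((φ ζ : ℂ) * conj ζ ^ 0 * (1 - 0 * conj ζ)⁻¹ ^ (0 + 1)))
      (fun ζ hζ => by simp [sub_eq_add_neg])
    rw [this]
    change _ = 2 * cau φ 0 z + -cau φ 0 0 + 0
    rw [herglotz]; ring
  have := circleAverage_lin_comb ((dd z : ℂ) • (Complex.conjCLE : ℂ →L[ℝ] ℂ))
    (((dd z : ℂ) ^ 2 * conj z) • (Complex.conjCLE : ℂ →L[ℝ] ℂ))
    (z • Complex.ofRealCLM.comp Complex.reCLM)
    (continuousOn_cau hφ 1 hz) (continuousOn_cau hφ 2 hz) hF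
    (f := fun ζ => (φ ζ : ℂ) * (dd z ^ 3 * ζ * (1 - conj z * ζ)⁻¹ ^ 3 * (1 - z * conj ζ)⁻¹))
    (fun ζ hζ => ?_)
  · rw [this, ← hh]
    change _ = (dd z : ℂ) * conj (cau φ 1 z) + ((dd z : ℂ) ^ 2 * conj z) * conj (cau φ 2 z)
      + z * (herglotz φ z).re
    simp only [diskGrad, holGrad, map_mul, map_ofNat]
    ring
  · dsimp only
    rw [← diskGrad_kernel hz hζ, ← re_herglotz_kernel hz hζ]
    simp only [ContinuousLinearMap.comp_apply, smul_apply, smul_eq_mul,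
      Complex.reCLM_apply, Complex.ofRealCLM_apply, pow_zero, mul_one, zero_add, pow_one, zero_mul,
      sub_zero, inv_one]
    have e3 : (2 * ((φ ζ : ℂ) * (1 - z * conj ζ)⁻¹) - φ ζ).re
        = φ ζ * (2 * ((1 - z * conj ζ)⁻¹).re - 1) := by
      rw [Complex.sub_re, show (2 : ℂ) * ((φ ζ : ℂ) * (1 - z * conj ζ)⁻¹)
        = ((2 * φ ζ : ℝ) : ℂ) * (1 - z * conj ζ)⁻¹ by push_cast; ring, Complex.re_ofReal_mul,
        Complex.ofReal_re]
      ring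
    rw [e3]
    simp
    ring

theorem L0_eq {X : ℂ → ℂ} (hX : IsCircleField X) {z : ℂ} (hz : z ∈ disk) :
    L0 X z = Complex.I * Real.circleAverage (fun ζ => (support X ζ : ℂ) *
      (dd z ^ 3 * ζ * (1 - conj z * ζ)⁻¹ ^ 3 * (1 - z * conj ζ)⁻¹)) 0 1 := by
  rw [← smul_eq_mul Complex.I, ← Real.circleAverage_smul, Real.circleAverage_eq_circleIntegral
    one_ne_zero, L0, one_sub_norm_sq]
  rw [div_eq_mul_inv, mul_comm ((dd z : ℂ) ^ 3), mul_assoc, ← smul_eq_mul (_⁻¹)]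
  congr 1
  rw [← circleIntegral.integral_const_mul]
  refine circleIntegral.integral_congr zero_le_one fun ζ hζ => ?_
  have h1 := one_sub_mul_conj_ne_zero hz hζ
  have h2 := one_sub_conj_mul_ne_zero hz hζ
  have h3 := mul_conj_eq_one hζ
  have h4 : ζ ≠ 0 := fun h => by simp [h] at h3
  -- One factor `ζ` of the denominator matches the `ζ⁻¹` that comes from writing the average as a
  -- contour integral.
  have h5 : ζ - z = ζ * (1 - z * conj ζ) := by linear_combination z * h3
  rw [h5, eq_support hX hζ]
  simp
  field_simp

/-! ### Boundary values -/

theorem herglotz_one {z : ℂ} (hz : z ∈ disk) : herglotz (fun _ => 1) z = 1 := by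
  have h00 : (0 : ℂ) ∈ disk := by simp [disk]
  rw [herglotz, cau_one 0 hz, cau_one 0 h00]; norm_num

/-- For `φ = 1` the Herglotz integral is 1 and the solution is the coordinate `x₀`. This is the
total mass of the kernel `P²`. -/
theorem circleAverage_pker_sq {z : ℂ} (hz : z ∈ disk) :
    Real.circleAverage (fun ζ => pker z ζ ^ 2) 0 1 = 2 * (dd z)⁻¹ - 1 := by
  have h := diskSol_eq (φ := fun _ => 1) continuousOn_const hz
  simp only [one_mul] at h
  rw [← h, diskSol, holSol, herglotz_one hz, cau_one 1 hz]
  simp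

theorem circleAverage_diskGrad_kernel {z : ℂ} (hz : z ∈ disk) :
    Real.circleAverage (fun ζ =>
      dd z ^ 3 * ζ * (1 - conj z * ζ)⁻¹ ^ 3 * (1 - z * conj ζ)⁻¹) 0 1 = z := by
  have h := diskGrad_eq (φ := fun _ => 1) continuousOn_const hz
  simp only [Complex.ofReal_one, one_mul] at h
  rw [← h, diskGrad, holGrad, herglotz_one hz, cau_one 1 hz, cau_one 2 hz]
  simp

theorem norm_diskGrad_kernel {z ζ : ℂ} (hz : z ∈ disk) (hζ : ζ ∈ Metric.sphere (0 : ℂ) 1) :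
    ‖(dd z : ℂ) ^ 3 * ζ * (1 - conj z * ζ)⁻¹ ^ 3 * (1 - z * conj ζ)⁻¹‖ = dd z * pker z ζ ^ 2 := by
  have h1 : ‖1 - conj z * ζ‖ = ‖1 - z * conj ζ‖ := by
    rw [← RCLike.norm_conj]; simp
  rw [norm_mul, norm_mul, norm_mul, norm_pow, norm_pow, norm_inv, norm_inv, h1, norm_eq_one hζ,
    Complex.norm_real, Real.norm_of_nonneg (dd_pos hz).le, pker, Complex.normSq_eq_norm_sq,
    norm_inv]
  ring

theorem continuous_dd : Continuous dd := contDiff_dd.continuous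

theorem dd_eq_zero {ζ : ℂ} (hζ : ζ ∈ Metric.sphere (0 : ℂ) 1) : dd ζ = 0 := by
  rw [← one_sub_norm_sq, norm_eq_one hζ]; norm_num

theorem tendsto_dd {ζ : ℂ} (hζ : ζ ∈ Metric.sphere (0 : ℂ) 1) :
    Filter.Tendsto dd (𝓝[disk] ζ) (𝓝 0) := by
  have := continuous_dd.tendsto ζ
  rw [dd_eq_zero hζ] at this
  exact this.mono_left nhdsWithin_le_nhds

theorem norm_one_sub_mul_conj {z ζ : ℂ} (hζ : ζ ∈ Metric.sphere (0 : ℂ) 1) :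
    ‖1 - z * conj ζ‖ = ‖ζ - z‖ := by
  have h : ζ - z = ζ * (1 - z * conj ζ) := by linear_combination z * mul_conj_eq_one hζ
  rw [h, norm_mul, norm_eq_one hζ, one_mul]

theorem continuousOn_abs_sub_mul_pker (hφ : ContinuousOn φ (Metric.sphere 0 1)) (a : ℝ) {z : ℂ}
    (hz : z ∈ disk) :
    ContinuousOn (fun ζ => |φ ζ - a| * (dd z * pker z ζ ^ 2)) (Metric.sphere 0 1) :=
  (hφ.sub continuousOn_const).abs.mul (continuousOn_const.mul ((continuousOn_pker hz).pow 2))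

/-- The weight `dd P²` has mass `2 - dd ≤ 2` and equals `dd³ / |ζ - z|⁴`, which tends to zero away
from `ζ₀`. It dominates the kernels of both the normalized solution and the gradient. -/
theorem tendsto_circleAverage_abs_sub (hφ : ContinuousOn φ (Metric.sphere 0 1)) {ζ₀ : ℂ}
    (hζ₀ : ζ₀ ∈ Metric.sphere (0 : ℂ) 1) :
    Filter.Tendsto (fun z => Real.circleAverage
      (fun ζ => |φ ζ - φ ζ₀| * (dd z * pker z ζ ^ 2)) 0 1) (𝓝[disk] ζ₀) (𝓝 0) := by
  rw [Metric.tendsto_nhds]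
  intro ε hε
  -- The near part contributes at most twice `ε / 3`, as the mass is below 2; the far part is less
  -- than the remaining `ε / 3`.
  obtain ⟨δ, hδ, hφδ⟩ := Metric.continuousOn_iff.1 hφ ζ₀ hζ₀ (ε / 3) (by positivity)
  obtain ⟨M, hM⟩ := (isCompact_sphere (0 : ℂ) 1).exists_bound_of_continuousOn
    (hφ.sub (continuousOn_const (c := φ ζ₀)))
  have hM0 : 0 ≤ M := (norm_nonneg _).trans (hM ζ₀ hζ₀)
  have hlim : Filter.Tendsto (fun z => M * (2 / δ) ^ 4 * dd z ^ 3) (𝓝[disk] ζ₀) (𝓝 0) := by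
    simpa using ((tendsto_dd hζ₀).pow 3).const_mul (M * (2 / δ) ^ 4)
  have hball : Metric.ball ζ₀ (δ / 2) ∈ 𝓝[disk] ζ₀ :=
    mem_nhdsWithin_of_mem_nhds (Metric.ball_mem_nhds _ (by positivity))
  filter_upwards [self_mem_nhdsWithin, hball,
    hlim.eventually_lt_const (show 0 < ε / 3 by positivity)]
    with z hz hzb hsmall
  have hd := dd_pos hz
  have hcont := continuousOn_abs_sub_mul_pker hφ (φ ζ₀) hz
  have hnn : 0 ≤ Real.circleAverage (fun ζ => |φ ζ - φ ζ₀| * (dd z * pker z ζ ^ 2)) 0 1 :=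
    Real.circleAverage_nonneg_of_nonneg fun ζ _ => by positivity
  rw [Real.dist_eq, sub_zero, abs_of_nonneg hnn]
  have hpt : ∀ ζ ∈ Metric.sphere (0 : ℂ) |(1 : ℝ)|, |φ ζ - φ ζ₀| * (dd z * pker z ζ ^ 2)
      ≤ (ε / 3 * dd z) * pker z ζ ^ 2 + M * (2 / δ) ^ 4 * dd z ^ 3 := fun ζ hζ => by
    rw [abs_one] at hζ
    have hC : 0 ≤ M * (2 / δ) ^ 4 * dd z ^ 3 := by positivity
    have hE : 0 ≤ (ε / 3 * dd z) * pker z ζ ^ 2 := by positivity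
    by_cases hn : dist ζ ζ₀ < δ
    · have h1 : |φ ζ - φ ζ₀| ≤ ε / 3 := (hφδ ζ hζ hn).le
      have h2 : |φ ζ - φ ζ₀| * (dd z * pker z ζ ^ 2) ≤ ε / 3 * (dd z * pker z ζ ^ 2) := by gcongr
      nlinarith
    · have h1 : |φ ζ - φ ζ₀| ≤ M := hM ζ hζ
      have h2 : δ / 2 ≤ ‖ζ - z‖ := by
        have h3 : dist z ζ₀ < δ / 2 := hzb
        have h4 := dist_triangle ζ z ζ₀
        rw [← dist_eq_norm]
        linarith
      have h3 : dd z * pker z ζ ^ 2 ≤ (2 / δ) ^ 4 * dd z ^ 3 := by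
        have e : dd z * pker z ζ ^ 2 = (‖ζ - z‖⁻¹) ^ 4 * dd z ^ 3 := by
          rw [pker, Complex.normSq_eq_norm_sq, norm_inv, norm_one_sub_mul_conj hζ]; ring
        rw [e, show 2 / δ = (δ / 2)⁻¹ by rw [inv_div]]
        gcongr
      have h4 : |φ ζ - φ ζ₀| * (dd z * pker z ζ ^ 2) ≤ M * ((2 / δ) ^ 4 * dd z ^ 3) := by gcongr
      nlinarith
  have i1 : CircleIntegrable (fun ζ => (ε / 3 * dd z) * pker z ζ ^ 2) 0 1 :=
    circleIntegrable_of_continuousOn (continuousOn_const.mul ((continuousOn_pker hz).pow 2))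
  have i2 : CircleIntegrable (fun _ : ℂ => M * (2 / δ) ^ 4 * dd z ^ 3) 0 1 :=
    circleIntegrable_of_continuousOn continuousOn_const
  have hle := Real.circleAverage_mono (circleIntegrable_of_continuousOn hcont)
    (i1.add i2) hpt
  have e1 := Real.circleAverage_fun_smul (c := 0) (R := 1) (a := ε / 3 * dd z)
    (f := fun ζ => pker z ζ ^ 2)
  simp only [smul_eq_mul] at e1
  rw [Real.circleAverage_add i1 i2, e1, circleAverage_pker_sq hz, Real.circleAverage_const] at hle
  have e2 : ε / 3 * dd z * (2 * (dd z)⁻¹ - 1) = ε / 3 * (2 - dd z) := by field_simp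
  rw [e2] at hle
  nlinarith

theorem tendsto_diskSol (hφ : ContinuousOn φ (Metric.sphere 0 1)) {ζ₀ : ℂ}
    (hζ₀ : ζ₀ ∈ Metric.sphere (0 : ℂ) 1) :
    Filter.Tendsto (fun z => diskSol φ z * (2 * (dd z)⁻¹ - 1)⁻¹) (𝓝[disk] ζ₀) (𝓝 (φ ζ₀)) := by
  rw [tendsto_iff_norm_sub_tendsto_zero]
  refine squeeze_zero' (.of_forall fun _ => norm_nonneg _) ?_ (tendsto_circleAverage_abs_sub hφ hζ₀)
  filter_upwards [self_mem_nhdsWithin] with z hz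
  have hd := dd_pos hz
  have hd1 := dd_le_one z
  have hp : 0 < 2 * (dd z)⁻¹ - 1 := by
    have := (one_le_inv₀ hd).2 hd1
    linarith
  have hk := (continuousOn_pker hz).pow 2
  have e1 := Real.circleAverage_fun_smul (c := 0) (R := 1) (a := φ ζ₀)
    (f := fun ζ => pker z ζ ^ 2)
  have e2 := Real.circleAverage_fun_sub (f₁ := fun ζ => φ ζ * pker z ζ ^ 2)
    (f₂ := fun ζ => φ ζ₀ * pker z ζ ^ 2) (circleIntegrable_of_continuousOn (hφ.mul hk))
    (circleIntegrable_of_continuousOn ((continuousOn_const (c := φ ζ₀)).mul hk))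
  have e3 := Real.circleAverage_fun_smul (c := 0) (R := 1) (a := dd z)
    (f := fun ζ => |φ ζ - φ ζ₀| * pker z ζ ^ 2)
  simp only [smul_eq_mul] at e1 e2 e3
  rw [← diskSol_eq hφ hz, e1, circleAverage_pker_sq hz] at e2
  have hn := norm_circleAverage_le (fun ζ => φ ζ * pker z ζ ^ 2 - φ ζ₀ * pker z ζ ^ 2)
  have e4 : (fun ζ => ‖φ ζ * pker z ζ ^ 2 - φ ζ₀ * pker z ζ ^ 2‖)
      = fun ζ => |φ ζ - φ ζ₀| * pker z ζ ^ 2 := by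
    funext ζ
    rw [← sub_mul, norm_mul, Real.norm_eq_abs, Real.norm_of_nonneg (sq_nonneg _)]
  rw [e2, e4] at hn
  have e5 : (fun ζ => |φ ζ - φ ζ₀| * (dd z * pker z ζ ^ 2))
      = fun ζ => dd z * (|φ ζ - φ ζ₀| * pker z ζ ^ 2) := by funext ζ; ring
  rw [e5, e3]
  have e6 : diskSol φ z * (2 * (dd z)⁻¹ - 1)⁻¹ - φ ζ₀
      = (2 * (dd z)⁻¹ - 1)⁻¹ * (diskSol φ z - φ ζ₀ * (2 * (dd z)⁻¹ - 1)) := by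
    generalize 2 * (dd z)⁻¹ - 1 = m at hp
    field_simp
  -- Dividing by the mass of `P²` costs no more than the factor `dd` in the weight.
  have h7 : (2 * (dd z)⁻¹ - 1)⁻¹ ≤ dd z := by
    rw [inv_le_comm₀ hp hd]
    have := (one_le_inv₀ hd).2 hd1
    linarith
  rw [e6, norm_mul, Real.norm_of_nonneg (inv_pos.2 hp).le]
  gcongr

theorem tendsto_diskGrad (hφ : ContinuousOn φ (Metric.sphere 0 1)) {ζ₀ : ℂ}
    (hζ₀ : ζ₀ ∈ Metric.sphere (0 : ℂ) 1) :
    Filter.Tendsto (diskGrad φ) (𝓝[disk] ζ₀) (𝓝 (ζ₀ * φ ζ₀)) := by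
  have hz0 : Filter.Tendsto (fun z : ℂ => z * (φ ζ₀ : ℂ)) (𝓝[disk] ζ₀) (𝓝 (ζ₀ * φ ζ₀)) :=
    ((continuous_id.mul continuous_const).tendsto ζ₀).mono_left nhdsWithin_le_nhds
  -- Here `z * φ ζ₀` is the gradient for the constant boundary value `φ ζ₀`, so the difference is an
  -- average of `φ - φ ζ₀` against the kernel.
  suffices h : Filter.Tendsto (fun z => diskGrad φ z - z * φ ζ₀) (𝓝[disk] ζ₀) (𝓝 0) by
    simpa using h.add hz0
  refine squeeze_zero_norm' ?_ (tendsto_circleAverage_abs_sub hφ hζ₀)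
  filter_upwards [self_mem_nhdsWithin] with z hz
  set K : ℂ → ℂ := fun ζ => dd z ^ 3 * ζ * (1 - conj z * ζ)⁻¹ ^ 3 * (1 - z * conj ζ)⁻¹ with hK
  have hKc : ContinuousOn K (Metric.sphere 0 1) :=
    ((continuousOn_const.mul continuousOn_id).mul
      ((ContinuousOn.inv₀ (by fun_prop) fun ζ hζ => one_sub_conj_mul_ne_zero hz hζ).pow 3)).mul
      (continuousOn_kernel hz)
  have hφC : ContinuousOn (fun ζ => (φ ζ : ℂ)) (Metric.sphere 0 1) :=
    Complex.continuous_ofReal.comp_continuousOn hφ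
  have e1 := Real.circleAverage_fun_smul (c := 0) (R := 1) (a := (φ ζ₀ : ℂ)) (f := K)
  have e2 := Real.circleAverage_fun_sub (f₁ := fun ζ => (φ ζ : ℂ) * K ζ)
    (f₂ := fun ζ => (φ ζ₀ : ℂ) * K ζ) (circleIntegrable_of_continuousOn (hφC.mul hKc))
    (circleIntegrable_of_continuousOn ((continuousOn_const (c := (φ ζ₀ : ℂ))).mul hKc))
  simp only [smul_eq_mul] at e1 e2
  rw [← diskGrad_eq hφ hz, e1, circleAverage_diskGrad_kernel hz, mul_comm _ z] at e2
  rw [← e2]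
  refine (norm_circleAverage_le _).trans (le_of_eq (Real.circleAverage_congr_sphere fun ζ hζ => ?_))
  rw [abs_one] at hζ
  rw [← sub_mul, norm_mul, norm_diskGrad_kernel hz hζ, ← Complex.ofReal_sub, Complex.norm_real,
    Real.norm_eq_abs]

/-! ### The Klein model -/

/-- The Klein model coordinate in terms of the Poincaré model coordinate. -/
def toKlein (z : ℂ) : ℂ := 2 * z * ((2 - dd z)⁻¹ : ℝ)

/-- The Poincaré model coordinate in terms of the Klein model coordinate. -/
def ofKlein (η : ℂ) : ℂ := η * ((1 + √(dd η))⁻¹ : ℝ)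

theorem two_sub_dd_pos (z : ℂ) : 0 < 2 - dd z := by linarith [dd_le_one z]

theorem dd_real_mul (z : ℂ) (t : ℝ) : dd (z * t) = 1 - (1 - dd z) * t ^ 2 := by
  simp [dd]; ring

theorem mem_disk_of_dd_pos {z : ℂ} (h : 0 < dd z) : z ∈ disk := by
  rw [← one_sub_norm_sq] at h
  have : ‖z‖ < 1 := by nlinarith [norm_nonneg z]
  simpa [disk] using this

theorem dd_toKlein (z : ℂ) : dd (toKlein z) = (dd z / (2 - dd z)) ^ 2 := by
  have h := (two_sub_dd_pos z).ne'
  rw [toKlein, show (2 : ℂ) * z * ((2 - dd z)⁻¹ : ℝ) = z * ((2 * (2 - dd z)⁻¹ : ℝ) : ℂ) by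
    push_cast; ring, dd_real_mul]
  field_simp
  ring

theorem toKlein_mem_disk {z : ℂ} (hz : z ∈ disk) : toKlein z ∈ disk := by
  have h := two_sub_dd_pos z
  have := dd_pos hz
  refine mem_disk_of_dd_pos ?_
  rw [dd_toKlein]; positivity

theorem sqrt_dd_toKlein {z : ℂ} (hz : z ∈ disk) : √(dd (toKlein z)) = (2 * (dd z)⁻¹ - 1)⁻¹ := by
  have h := two_sub_dd_pos z
  have hd := dd_pos hz
  rw [dd_toKlein, Real.sqrt_sq (by positivity), show 2 * (dd z)⁻¹ - 1 = (2 - dd z) / dd z by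
    field_simp, inv_div]

theorem kleinInv_toKlein {z : ℂ} (hz : z ∈ disk) : kleinInv (toKlein z) = Ginv z := by
  have h := two_sub_dd_pos z
  have hd := dd_pos hz
  rw [kleinInv, one_sub_norm_sq, sqrt_dd_toKlein hz, Ginv_eq_of_mem hz]
  have e : (2 * (dd z)⁻¹ - 1) = (2 - dd z) * (dd z)⁻¹ := by field_simp
  ext i
  fin_cases i
  · simp
  · simp [toKlein, -Complex.ofReal_inv, e]
    field_simp
  · simp [toKlein, -Complex.ofReal_inv, e]
    field_simp

theorem dd_ofKlein {η : ℂ} (hη : η ∈ disk) : dd (ofKlein η) = 2 * √(dd η) / (1 + √(dd η)) := by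
  have h := Real.sqrt_pos.2 (dd_pos hη)
  have h2 := Real.sq_sqrt (dd_pos hη).le
  rw [ofKlein, dd_real_mul, ← h2]
  simp only [Real.sqrt_sq h.le]
  field_simp
  ring

theorem ofKlein_mem_disk {η : ℂ} (hη : η ∈ disk) : ofKlein η ∈ disk := by
  have h := Real.sqrt_pos.2 (dd_pos hη)
  refine mem_disk_of_dd_pos ?_
  rw [dd_ofKlein hη]; positivity

theorem toKlein_ofKlein {η : ℂ} (hη : η ∈ disk) : toKlein (ofKlein η) = η := by
  have h := Real.sqrt_pos.2 (dd_pos hη)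
  have e : 2 * (1 + √(dd η))⁻¹ * (2 - 2 * √(dd η) / (1 + √(dd η)))⁻¹ = 1 := by
    have : 2 - 2 * √(dd η) / (1 + √(dd η)) = 2 / (1 + √(dd η)) := by field_simp; ring
    rw [this]; field_simp
  have eC := congrArg (fun t : ℝ => (t : ℂ)) e
  rw [toKlein, dd_ofKlein hη, ofKlein]
  push_cast at eC ⊢
  linear_combination η * eC

theorem kleinInv_eq {η : ℂ} (hη : η ∈ disk) : kleinInv η = Ginv (ofKlein η) := by
  conv_lhs => rw [← toKlein_ofKlein hη]
  exact kleinInv_toKlein (ofKlein_mem_disk hη)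

theorem tendsto_toKlein {ζ : ℂ} (hζ : ζ ∈ Metric.sphere (0 : ℂ) 1) :
    Filter.Tendsto toKlein (𝓝[disk] ζ) (𝓝[disk] ζ) := by
  have hc : Continuous toKlein := by
    refine (continuous_const.mul continuous_id).mul (Complex.continuous_ofReal.comp
      ((continuous_const.sub continuous_dd).inv₀ fun z => (two_sub_dd_pos z).ne'))
  have h := hc.tendsto ζ
  have h1 : toKlein ζ = ζ := by
    rw [toKlein, dd_eq_zero hζ]; push_cast; ring
  rw [h1] at h
  exact tendsto_nhdsWithin_of_tendsto_nhds_of_eventually_within _ (h.mono_left nhdsWithin_le_nhds)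
    (Filter.eventually_of_mem self_mem_nhdsWithin fun z hz => toKlein_mem_disk hz)

theorem tendsto_ofKlein {ζ : ℂ} (hζ : ζ ∈ Metric.sphere (0 : ℂ) 1) :
    Filter.Tendsto ofKlein (𝓝[disk] ζ) (𝓝[disk] ζ) := by
  have hc : Continuous ofKlein := by
    refine continuous_id.mul (Complex.continuous_ofReal.comp
      ((continuous_const.add (Real.continuous_sqrt.comp continuous_dd)).inv₀ fun z => ?_))
    exact (add_pos_of_pos_of_nonneg one_pos (Real.sqrt_nonneg _)).ne'
  have h := hc.tendsto ζ
  have h1 : ofKlein ζ = ζ := by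
    rw [ofKlein, dd_eq_zero hζ]; simp
  rw [h1] at h
  exact tendsto_nhdsWithin_of_tendsto_nhds_of_eventually_within _ (h.mono_left nhdsWithin_le_nhds)
    (Filter.eventually_of_mem self_mem_nhdsWithin fun z hz => ofKlein_mem_disk hz)

theorem bar_toKlein (u : (Fin 3 → ℝ) → ℝ) {z : ℂ} (hz : z ∈ disk) :
    bar u (toKlein z) = u (Ginv z) * (2 * (dd z)⁻¹ - 1)⁻¹ := by
  rw [bar, one_sub_norm_sq, sqrt_dd_toKlein hz, kleinInv_toKlein hz, mul_comm]

/-- The weight `√(1 - |η|²)` is `1 / x₀`, and the coordinate change and its inverse preserve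
approach to each boundary point. -/
theorem hasBoundaryValue_bar_iff (u : (Fin 3 → ℝ) → ℝ) (φ : ℂ → ℝ) :
    HasBoundaryValue (bar u) φ ↔
      HasBoundaryValue (fun z => u (Ginv z) * (2 * (dd z)⁻¹ - 1)⁻¹) φ := by
  refine ⟨fun h ζ hζ => ?_, fun h ζ hζ => ?_⟩
  · refine ((h ζ hζ).comp (tendsto_toKlein hζ)).congr' ?_
    filter_upwards [self_mem_nhdsWithin] with z hz using bar_toKlein u hz
  · refine ((h ζ hζ).comp (tendsto_ofKlein hζ)).congr' ?_
    filter_upwards [self_mem_nhdsWithin] with η hη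
    have := bar_toKlein u (ofKlein_mem_disk hη)
    rw [toKlein_ofKlein hη] at this
    exact this.symm

theorem klein_Ginv {z : ℂ} (hz : z ∈ disk) : klein (Ginv z) = toKlein z := by
  have h := two_sub_dd_pos z
  have hd := dd_pos hz
  have e : (2 * (dd z)⁻¹ - 1) = (2 - dd z) * (dd z)⁻¹ := by field_simp
  rw [Ginv_eq_of_mem hz]
  apply Complex.ext <;> simp [klein, toKlein, -Complex.ofReal_inv, e] <;> field_simp

theorem hasWirt_toKlein (z : ℂ) :
    HasWirt toKlein (2 * ((2 - dd z)⁻¹ : ℝ) - 2 * z * conj z * ((2 - dd z)⁻¹ : ℝ) ^ 2)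
      (-2 * z ^ 2 * ((2 - dd z)⁻¹ : ℝ) ^ 2) z := by
  have hne : (2 : ℂ) + -1 * (dd z : ℂ) ≠ 0 := by
    have := Complex.ofReal_ne_zero.2 (two_sub_dd_pos z).ne'
    push_cast at this
    rwa [neg_one_mul, ← sub_eq_add_neg]
  have h := ((HasWirt.id z).const_mul 2).mul
    (((HasWirt.const 2 z).add ((hasWirt_dd z).const_mul (-1))).inv hne)
  have he : (fun y : ℂ => 2 * y * (2 + -1 * (dd y : ℂ))⁻¹) = toKlein := by
    funext y
    rw [toKlein, neg_one_mul, ← sub_eq_add_neg]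
    push_cast
    rfl
  rw [he] at h
  refine h.congr_deriv ?_ ?_ <;> push_cast <;> 
    rw [neg_one_mul, ← sub_eq_add_neg, div_eq_mul_inv, ← inv_pow] <;> ring

theorem differentiableAt_klein {p : Fin 3 → ℝ} (hp : p ∈ H2) : DifferentiableAt ℝ klein p := by
  have h0 := hp.2.ne'
  have : klein = fun x => Complex.equivRealProdCLM.symm (x 1 / x 0, x 2 / x 0) := by
    funext x; apply Complex.ext <;> simp [klein]
  rw [this]
  fun_prop (disch := assumption)

theorem fderiv_klein_fderiv_Ginv {z : ℂ} (hz : z ∈ disk) (v : ℂ) :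
    fderiv ℝ klein (Ginv z) (fderiv ℝ Ginv z v)
      = (2 * ((2 - dd z)⁻¹ : ℝ) - 2 * z * conj z * ((2 - dd z)⁻¹ : ℝ) ^ 2) * v
        + (-2 * z ^ 2 * ((2 - dd z)⁻¹ : ℝ) ^ 2) * conj v := by
  have h1 : HasFDerivAt (klein ∘ Ginv) ((fderiv ℝ klein (Ginv z)).comp (fderiv ℝ Ginv z)) z :=
    (differentiableAt_klein (Ginv_mem_H2 hz)).hasFDerivAt.comp z
      (hasFDerivAt_Ginv hz).differentiableAt.hasFDerivAt
  have h2 : HasFDerivAt (klein ∘ Ginv) _ z := HasFDerivAt.congr_of_eventuallyEq (hasWirt_toKlein z)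
      (Filter.eventually_of_mem (disk_mem_nhds hz) fun y hy => klein_Ginv hy)
  simpa using congrArg (fun L : ℂ →L[ℝ] ℂ => L v) (h1.unique h2)

/-- At `ζ` on the circle the differential of `toKlein` is `v ↦ (v - ζ² v̄)/2`, the projection onto
the tangent line, and `X ζ` is tangent. -/
theorem hasBoundaryValue_kleinPush_J_grad {u : (Fin 3 → ℝ) → ℝ} {X : ℂ → ℂ} (hX : IsCircleField X)
    (h : HasBoundaryValue (GPush (J (grad u))) X) :
    HasBoundaryValue (kleinPush (J (grad u))) X := fun ζ hζ => by
  have hV := h ζ hζ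
  have hz : Filter.Tendsto (fun z : ℂ => z) (𝓝[disk] ζ) (𝓝 ζ) := nhdsWithin_le_nhds
  have he : Filter.Tendsto (fun z => (((2 - dd z)⁻¹ : ℝ) : ℂ)) (𝓝[disk] ζ)
      (𝓝 ((1 / 2 : ℝ) : ℂ)) := by
    have := (tendsto_dd hζ).const_sub 2
    have := this.inv₀ (by norm_num)
    exact (Complex.continuous_ofReal.tendsto _).comp (by simpa using this)
  have hc : Filter.Tendsto (fun z : ℂ => conj z) (𝓝[disk] ζ) (𝓝 (conj ζ)) :=
    (Complex.continuous_conj.tendsto ζ).comp hz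
  have hcV := (Complex.continuous_conj.tendsto _).comp hV
  have hlim := (((he.const_mul 2).sub (((hz.const_mul 2).mul hc).mul (he.pow 2))).mul hV).add
    ((((hz.pow 2).const_mul (-2)).mul (he.pow 2)).mul hcV)
  have hval : (2 * ((1 / 2 : ℝ) : ℂ) - 2 * ζ * conj ζ * ((1 / 2 : ℝ) : ℂ) ^ 2) * X ζ
      + -2 * ζ ^ 2 * ((1 / 2 : ℝ) : ℂ) ^ 2 * conj (X ζ) = X ζ := by
    have h3 := mul_conj_eq_one hζ
    have h4 : conj ζ * X ζ + ζ * conj (X ζ) = 0 := by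
      have := Complex.add_conj (conj ζ * X ζ)
      rw [hX.2 ζ hζ] at this
      simpa using this
    push_cast
    linear_combination (-1 / 2 * ζ) * h4
  rw [hval] at hlim
  refine (hlim.comp (tendsto_ofKlein hζ)).congr' ?_
  filter_upwards [self_mem_nhdsWithin] with η hη
  have hk := ofKlein_mem_disk hη
  rw [kleinPush, kleinInv_eq hη, J_grad_Ginv u hk, fderiv_klein_fderiv_Ginv hk, ← GPush_J_grad u hk]
  rfl

/-! ### Uniqueness by the maximum principle -/

/-- The second derivative of `f` at `z` in the direction `a`. -/
def dirDeriv2 (f : ℂ → ℝ) (a z : ℂ) : ℝ := fderiv ℝ (fun y => fderiv ℝ f y a) z a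

/-- A positive second derivative would make `t` a local minimum too, hence `s` locally constant, a
contradiction. -/
theorem deriv_deriv_nonpos_of_isLocalMax {s : ℝ → ℝ} {t : ℝ} (hc : ContinuousAt s t)
    (h : IsLocalMax s t) : deriv (deriv s) t ≤ 0 := by
  by_contra! hpos
  have hmin := isLocalMin_of_deriv_deriv_pos hpos h.deriv_eq_zero hc
  have hconst : s =ᶠ[𝓝 t] fun _ => s t := by
    filter_upwards [h, hmin] with x h1 h2 using le_antisymm h1 h2
  have h1 : deriv s =ᶠ[𝓝 t] deriv fun _ => s t := hconst.deriv
  have h2 := h1.deriv_eq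
  simp at h2
  exact hpos.ne' h2

theorem differentiableAt_fderiv_apply {f : ℂ → ℝ} {z : ℂ} (hf : ContDiffAt ℝ 2 f z) (a : ℂ) :
    DifferentiableAt ℝ (fun y => fderiv ℝ f y a) z :=
  ((hf.fderiv_right (m := 1) (by norm_num)).differentiableAt (by norm_num)).clm_apply
    (differentiableAt_const a)

theorem eventually_differentiableAt {f : ℂ → ℝ} {z : ℂ} (hf : ContDiffAt ℝ 2 f z) :
    ∀ᶠ y in 𝓝 z, DifferentiableAt ℝ f y :=
  (hf.eventually (by simp)).mono fun _ hy => hy.differentiableAt (by norm_num)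

theorem dirDeriv2_nonpos_of_isLocalMax {f : ℂ → ℝ} {z : ℂ} (hf : ContDiffAt ℝ 2 f z)
    (h : IsLocalMax f z) (a : ℂ) : dirDeriv2 f a z ≤ 0 := by
  have hl : ∀ t : ℝ, HasDerivAt (fun t : ℝ => z + t • a) a t := fun t => by
    simpa using ((hasDerivAt_id t).smul_const a).const_add z
  have h0 : z + (0 : ℝ) • a = z := by simp
  have hcl : ContinuousAt (fun t : ℝ => z + t • a) 0 := (hl 0).continuousAt
  have hcl' : Filter.Tendsto (fun t : ℝ => z + t • a) (𝓝 0) (𝓝 z) := by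
    have := hcl.tendsto
    rwa [h0] at this
  have hd : deriv (fun t : ℝ => f (z + t • a)) =ᶠ[𝓝 0] fun t => fderiv ℝ f (z + t • a) a := by
    filter_upwards [hcl'.eventually (eventually_differentiableAt hf)] with t ht
    exact (ht.hasFDerivAt.comp_hasDerivAt t (hl t)).deriv
  have hdd : deriv (deriv fun t : ℝ => f (z + t • a)) 0 = dirDeriv2 f a z := by
    rw [hd.deriv_eq]
    have h1 : HasFDerivAt (fun y => fderiv ℝ f y a) (fderiv ℝ (fun y => fderiv ℝ f y a) z)
        (z + (0 : ℝ) • a) := by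
      rw [h0]; exact (differentiableAt_fderiv_apply hf a).hasFDerivAt
    exact (h1.comp_hasDerivAt (0 : ℝ) (hl 0)).deriv
  rw [← hdd]
  refine deriv_deriv_nonpos_of_isLocalMax ?_ ?_
  · exact ContinuousAt.comp (by rw [h0]; exact hf.continuousAt) hcl
  · have := hcl'.eventually h
    simpa [IsLocalMax, IsMaxFilter] using this

theorem dirDeriv2_sub {f g : ℂ → ℝ} {z : ℂ} (hf : ContDiffAt ℝ 2 f z) (hg : ContDiffAt ℝ 2 g z)
    (a : ℂ) : dirDeriv2 (fun y => f y - g y) a z = dirDeriv2 f a z - dirDeriv2 g a z := by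
  have h : (fun y => fderiv ℝ (fun y => f y - g y) y a) =ᶠ[𝓝 z]
      fun y => fderiv ℝ f y a - fderiv ℝ g y a := by
    filter_upwards [eventually_differentiableAt hf, eventually_differentiableAt hg] with y h1 h2
    rw [fderiv_fun_sub h1 h2]; rfl
  rw [dirDeriv2, h.fderiv_eq, fderiv_fun_sub (differentiableAt_fderiv_apply hf a)
    (differentiableAt_fderiv_apply hg a)]
  rfl

theorem dirDeriv2_const_mul_dd_inv (M : ℝ) {z : ℂ} (hz : z ∈ disk) (a : ℂ) :
    dirDeriv2 (fun y => M * (dd y)⁻¹) a z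
      = M * (8 * (dd z)⁻¹ ^ 3 * ip z a ^ 2 + 2 * (dd z)⁻¹ ^ 2 * ip a a) := by
  have h : (fun y => fderiv ℝ (fun y => M * (dd y)⁻¹) y a) =ᶠ[𝓝 z]
      fun y => M * (2 * (dd y)⁻¹ ^ 2) * ipCLM a y := by
    filter_upwards [disk_mem_nhds hz] with y hy
    rw [((hasFDerivAt_dd_inv hy).const_mul M).fderiv]
    simp; ring
  have h2 := (((((hasFDerivAt_dd_inv hz).pow 2).const_mul 2).const_mul M).mul
    (ipCLM a).hasFDerivAt)
  rw [dirDeriv2, h.fderiv_eq]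
  refine (congrArg (fun L : ℂ →L[ℝ] ℝ => L a) h2.fderiv).trans ?_
  simp [ip, -inv_pow]
  ring

theorem contDiffAt_dd_inv {z : ℂ} (hz : z ∈ disk) (M : ℝ) :
    ContDiffAt ℝ 2 (fun y => M * (dd y)⁻¹) z :=
  contDiffAt_const.mul (((contDiff_dd.of_le (ENat.LEInfty.out)).contDiffAt).inv
    (dd_pos hz).ne')

theorem le_of_solves {f₁ f₂ φ : ℂ → ℝ} (h₁ : ContDiffOn ℝ 2 f₁ disk) (h₂ : ContDiffOn ℝ 2 f₂ disk)
    (e₁ : ∀ z ∈ disk, dd z ^ 2 / 4 * (dirDeriv2 f₁ 1 z + dirDeriv2 f₁ Complex.I z) = 2 * f₁ z)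
    (e₂ : ∀ z ∈ disk, dd z ^ 2 / 4 * (dirDeriv2 f₂ 1 z + dirDeriv2 f₂ Complex.I z) = 2 * f₂ z)
    (b₁ : HasBoundaryValue (fun z => f₁ z * (2 * (dd z)⁻¹ - 1)⁻¹) φ)
    (b₂ : HasBoundaryValue (fun z => f₂ z * (2 * (dd z)⁻¹ - 1)⁻¹) φ) :
    ∀ z ∈ disk, f₁ z ≤ f₂ z := by
  classical
  by_contra! hex
  obtain ⟨z₁, hz₁, hlt⟩ := hex
  -- Equal boundary values make this extension by zero continuous on the closed disk, since `dd` is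
  -- `2 - dd` times the normalizing factor. A positive value then forces an interior maximum.
  set H : ℂ → ℝ := disk.indicator fun z => (f₁ z - f₂ z) * dd z with hH
  have hHz : ∀ z ∈ disk, H z = (f₁ z - f₂ z) * dd z := fun z hz => Set.indicator_of_mem hz _
  have hcont : ContinuousOn H (Metric.closedBall 0 1) := fun ζ hζ => by
    refine ContinuousAt.continuousWithinAt ?_
    by_cases hm : ζ ∈ disk
    · have : ContinuousAt (fun z => (f₁ z - f₂ z) * dd z) ζ :=
        ((h₁.continuousOn.continuousAt (disk_mem_nhds hm)).sub
          (h₂.continuousOn.continuousAt (disk_mem_nhds hm))).mul continuous_dd.continuousAt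
      exact this.congr (Filter.eventually_of_mem (disk_mem_nhds hm) fun y hy => (hHz y hy).symm)
    · have hs : ζ ∈ Metric.sphere (0 : ℂ) 1 := by
        simp [disk] at hm hζ ⊢
        exact le_antisymm hζ hm
      have hH0 : H ζ = 0 := Set.indicator_of_notMem hm _
      rw [ContinuousAt, hH0, ← nhdsWithin_univ, ← Set.union_compl_self disk, nhdsWithin_union]
      refine Filter.Tendsto.sup ?_ ?_
      · have hl := ((b₁ ζ hs).sub (b₂ ζ hs)).mul ((tendsto_dd hs).const_sub 2)
        simp only [sub_self, zero_mul] at hl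
        refine hl.congr' ?_
        filter_upwards [self_mem_nhdsWithin] with z hz
        have hd := dd_pos hz
        have h2 := two_sub_dd_pos z
        have e : (2 * (dd z)⁻¹ - 1) = (2 - dd z) * (dd z)⁻¹ := by field_simp
        rw [hHz z hz, e]
        field_simp
      · refine tendsto_const_nhds.congr' ?_
        filter_upwards [self_mem_nhdsWithin] with z hz
        exact (Set.indicator_of_notMem hz _).symm
  obtain ⟨z₀, hz₀, hmax⟩ := (isCompact_closedBall (0 : ℂ) 1).exists_isMaxOn
    ⟨z₁, Metric.ball_subset_closedBall hz₁⟩ hcont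
  have hMpos : 0 < H z₀ := by
    refine lt_of_lt_of_le ?_ (hmax (Metric.ball_subset_closedBall hz₁))
    change 0 < H z₁
    rw [hHz z₁ hz₁]
    exact mul_pos (sub_pos.2 hlt) (dd_pos hz₁)
  have hm : z₀ ∈ disk := by
    by_contra hn
    rw [hH, Set.indicator_of_notMem hn] at hMpos
    exact lt_irrefl _ hMpos
  set M := H z₀ with hM
  have hd := dd_pos hm
  have c₁ := h₁.contDiffAt (disk_mem_nhds hm)
  have c₂ := h₂.contDiffAt (disk_mem_nhds hm)
  have c₃ := contDiffAt_dd_inv hm M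
  -- `M / dd` touches `f₁ - f₂` from above at `z₀`. Comparing with a multiple of `x₀`, itself a
  -- solution, would give no strict inequality; `1/dd` leaves the surplus `-M`.
  have hloc : IsLocalMax (fun z => f₁ z - f₂ z - M * (dd z)⁻¹) z₀ := by
    filter_upwards [disk_mem_nhds hm] with z hz
    have hdz := dd_pos hz
    have k1 : (f₁ z - f₂ z) * dd z ≤ M := by
      rw [← hHz z hz]; exact hmax (Metric.ball_subset_closedBall hz)
    have k2 : f₁ z₀ - f₂ z₀ - M * (dd z₀)⁻¹ = 0 := by
      rw [hM, hHz z₀ hm]; field_simp; ring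
    rw [k2, sub_nonpos, ← div_eq_mul_inv, le_div_iff₀ hdz]
    exact k1
  have s1 := dirDeriv2_nonpos_of_isLocalMax ((c₁.sub c₂).sub c₃) hloc 1
  have s2 := dirDeriv2_nonpos_of_isLocalMax ((c₁.sub c₂).sub c₃) hloc Complex.I
  rw [dirDeriv2_sub (c₁.sub c₂) c₃, dirDeriv2_sub c₁ c₂, dirDeriv2_const_mul_dd_inv M hm] at s1 s2
  have hv : (f₁ z₀ - f₂ z₀) * dd z₀ = M := (hHz z₀ hm).symm
  have q1 := e₁ z₀ hm
  have q2 := e₂ z₀ hm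
  have hr : ip z₀ 1 ^ 2 + ip z₀ Complex.I ^ 2 = 1 - dd z₀ := by simp [ip, dd]; ring
  have hi1 : ip 1 1 = 1 := by simp [ip]
  have hiI : ip Complex.I Complex.I = 1 := by simp [ip]
  rw [hi1] at s1
  rw [hiI] at s2
  set e := (dd z₀)⁻¹ with he
  have hde : dd z₀ * e = 1 := mul_inv_cancel₀ hd.ne'
  have hsum : dd z₀ ^ 2 / 4 * ((dirDeriv2 f₁ 1 z₀ + dirDeriv2 f₁ Complex.I z₀)
      - (dirDeriv2 f₂ 1 z₀ + dirDeriv2 f₂ Complex.I z₀)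
      - M * (8 * e ^ 3 * (ip z₀ 1 ^ 2 + ip z₀ Complex.I ^ 2) + 4 * e ^ 2)) ≤ 0 :=
    mul_nonpos_of_nonneg_of_nonpos (by positivity) (by linarith)
  rw [hr] at hsum
  have hval : dd z₀ ^ 2 / 4 * (M * (8 * e ^ 3 * (1 - dd z₀) + 4 * e ^ 2)) = 2 * (M * e) - M := by
    rw [he]; field_simp; ring
  have hf : f₁ z₀ - f₂ z₀ = M * e := by rw [← hv, mul_assoc, hde, mul_one]
  rw [mul_sub, mul_sub, q1, q2, hval] at hsum
  linarith

theorem dirDeriv2_of_laplacian {u : (Fin 3 → ℝ) → ℝ} (hu : ContDiffH2 2 u)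
    (h : ∀ p ∈ H2, laplacian u p - 2 * u p = 0) : ∀ z ∈ disk, dd z ^ 2 / 4 *
      (dirDeriv2 (fun z => u (Ginv z)) 1 z + dirDeriv2 (fun z => u (Ginv z)) Complex.I z)
        = 2 * u (Ginv z) := fun z hz => by
  have hc : ContDiffAt ℝ 2 (fun z => u (Ginv z)) z := ContDiffOn.contDiffAt hu (disk_mem_nhds hz)
  have h1 := laplacian_Ginv_of_differentiableAt hz (differentiableAt_fderiv_apply hc 1)
    (differentiableAt_fderiv_apply hc Complex.I)
  have h2 := h _ (Ginv_mem_H2 hz)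
  simp only [dirDeriv2]
  rw [← h1]
  linarith

theorem SolvesDirichlet.eqOn {φ : ℂ → ℝ} {u u' : (Fin 3 → ℝ) → ℝ} (hu : ContDiffH2 2 u)
    (hu' : ContDiffH2 2 u') (h : SolvesDirichlet φ u) (h' : SolvesDirichlet φ u') :
    Set.EqOn u' u H2 := fun p hp => by
  have e := dirDeriv2_of_laplacian hu h.1
  have e' := dirDeriv2_of_laplacian hu' h'.1
  have b := (hasBoundaryValue_bar_iff u φ).1 h.2
  have b' := (hasBoundaryValue_bar_iff u' φ).1 h'.2
  have hle := le_of_solves hu hu' e e' b b' _ (G_mem_disk hp)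
  have hge := le_of_solves hu' hu e' e b' b _ (G_mem_disk hp)
  rw [Ginv_G hp] at hle hge
  exact le_antisymm hge hle

/-! ### The main theorem -/

theorem continuousOn_support {X : ℂ → ℂ} (hX : IsCircleField X) :
    ContinuousOn (support X) (Metric.sphere 0 1) := by
  refine Complex.continuous_re.comp_continuousOn (hX.1.div (by fun_prop) fun ζ hζ h => ?_)
  have := norm_eq_one hζ
  simp_all

end

end HLExt

open HLExt in
theorem theorem1p3 (X : ℂ → ℂ) (hX : HLExt.IsCircleField X) :
    ∃ u : (Fin 3 → ℝ) → ℝ,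
      -- `u = u_X` is the unique solution with boundary value `φ_X`
      HLExt.ContDiffH2 ∞ u ∧ HLExt.SolvesDirichlet (HLExt.support X) u ∧
      (∀ u' : (Fin 3 → ℝ) → ℝ, HLExt.ContDiffH2 2 u' → HLExt.SolvesDirichlet (HLExt.support X) u' →
        Set.EqOn u' u HLExt.H2) ∧
      -- `HL(X) = J grad u_X` is harmonic Lagrangian and extends continuously to `X`,
      -- both in the Klein model and in the Poincaré model
      HLExt.IsHarmonicLagrangian (HLExt.J (HLExt.grad u)) ∧
      HLExt.HasBoundaryValue (HLExt.kleinPush (HLExt.J (HLExt.grad u))) X ∧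
      HLExt.HasBoundaryValue (HLExt.GPush (HLExt.J (HLExt.grad u))) X ∧
      -- `G_* HL(X) = L₀(X)`
      Set.EqOn (HLExt.GPush (HLExt.J (HLExt.grad u))) (HLExt.L0 X) HLExt.disk := by
  have hφ := continuousOn_support hX
  set φ := support X with hφX
  -- The coefficients 2, 4, 12, 48 arise from the factor `k + 1` in the derivative of `cau φ k`.
  -- Four derivatives are needed because harmonicity differentiates the gradient, which contains
  -- `F''`, twice more.
  have h0 : ∀ z ∈ disk, HasDerivAt (herglotz φ) (2 * cau φ 1 z) z :=
    fun z hz => hasDerivAt_herglotz hφ hz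
  have h1 : ∀ z ∈ disk, HasDerivAt (fun z => 2 * cau φ 1 z) (4 * cau φ 2 z) z :=
    fun z hz => hasDerivAt_const_mul_cau hφ 1 (by norm_num) hz
  have h2 : ∀ z ∈ disk, HasDerivAt (fun z => 4 * cau φ 2 z) (12 * cau φ 3 z) z :=
    fun z hz => hasDerivAt_const_mul_cau hφ 2 (by norm_num) hz
  have h3 : ∀ z ∈ disk, HasDerivAt (fun z => 12 * cau φ 3 z) (48 * cau φ 4 z) z :=
    fun z hz => hasDerivAt_const_mul_cau hφ 3 (by norm_num) hz
  have hu : ∀ z ∈ disk, (fun p => diskSol φ (G p)) (Ginv z) = diskSol φ z := fun z hz => by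
    simp only [G_Ginv hz]
  have hsmooth : ContDiffH2 ∞ fun p => diskSol φ (G p) := (contDiffOn_holSol h0 h1).congr hu
  have hsol : SolvesDirichlet φ fun p => diskSol φ (G p) := by
    refine ⟨fun p hp => ?_, (hasBoundaryValue_bar_iff _ φ).2 fun ζ hζ => ?_⟩
    · have := laplacian_of_holSol (u := fun p => diskSol φ (G p)) hu h0 h1 h2 (G_mem_disk hp)
      rw [Ginv_G hp] at this
      rw [this, sub_self]
    · refine (tendsto_diskSol hφ hζ).congr' ?_
      filter_upwards [self_mem_nhdsWithin] with z hz
      rw [← hu z hz]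
  have hpush : ∀ z ∈ disk, GPush (J (grad fun p => diskSol φ (G p))) z
      = Complex.I * diskGrad φ z := fun z hz => GPush_J_grad_of_holSol hu h0 h1 hz
  have hbd : HasBoundaryValue (GPush (J (grad fun p => diskSol φ (G p)))) X := fun ζ hζ => by
    have h := (tendsto_diskGrad hφ hζ).const_mul Complex.I
    rw [← mul_assoc, hφX, ← eq_support hX hζ] at h
    refine h.congr' ?_
    filter_upwards [self_mem_nhdsWithin] with z hz using (hpush z hz).symm
  refine ⟨fun p => diskSol φ (G p), hsmooth, hsol, fun u' hu' h' => ?_,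
    isHarmonicLagrangian_of_holSol hu h0 h1 h2 h3, hasBoundaryValue_kleinPush_J_grad hX hbd, hbd,
    fun z hz => ?_⟩
  · exact SolvesDirichlet.eqOn (hsmooth.of_le (ENat.LEInfty.out)) hu' hsol h'
  · rw [hpush z hz, L0_eq hX hz, diskGrad_eq hφ hz]
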